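/- Let $\varphi:\mathbb R\to\mathbb R$ be an admissible kernel: $\varphi\in C^\infty(\mathbb R)$, $\varphi(t)>0$ and $\varphi(-t)=\varphi(t)$ for all $t\in\mathbb R$, $\varphi'(t)<0$ for $t>0$, and there is an $\varepsilon>0$ such that $\varphi^{(n)}(t)=O(\exp(-|t|^{2+\varepsilon}))$ as $t\to\infty$ for every $n=0,1,2,\dots$. Assume that $\varphi$ is strictly logarithmically concave for $t>0$, that is, $(\log\varphi)''(t)<0$ for all $t>0$. For $z\in\mathbb C$, $t\in\mathbb R$ and $n=0,1,2,\dots$ put $$F(z)=\int_{-\infty}^{\infty}e^{itz}\varphi(t)\,dt,\qquad K_n(t)=\int_{-\infty}^{\infty}\varphi(s+t)\varphi(s-t)s^{2n}\,ds .$$ Then these integrals converge absolutely, $F$ is a real entire function (entire, and real on the real axis), each $K_n$ is integrable on $\mathbb R$, and for all $n=0,1,2,\dots$ and $x\in\mathbb R$ $$L_n(x;F):=\sum_{j=0}^{2n}\frac{(-1)^{j+n}}{(2n)!}\binom{2n}{j}F^{(j)}(x)F^{(2n-j)}(x)=\frac{2\cdot 2^{2n}}{(2n)!}\int_{-\infty}^{\infty}K_n(t)\cos(2xt)\,dt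 .$$ Moreover, $F$ belongs to the Laguerre–Pólya class if and only if $K_n$ is positive definite for every $n=0,1,2,\dots$. Here a real entire function $f$ belongs to the Laguerre–Pólya class if $$f(z)=Ce^{-az^2+bz}z^m\prod_{k}\left(1-\frac{z}{z_k}\right)e^{z/z_k},$$ where the product is over a finite (possibly empty) or countably infinite family, $C,b\in\mathbb R$, $a\ge 0$, $m$ is a non-negative integer, $z_k\in\mathbb R\setminus\{0\}$ and $\sum_k 1/z_k^2<\infty$. A continuous function $\psi:\mathbb R\to\mathbb R$ is positive definite if $$\int_{-\infty}^{\infty}\int_{-\infty}^{\infty}\psi(t-s)\rho(t)\overline{\rho(s)}\,dt\,ds\ge 0$$ (that is, the integral is real and non-negative) for every integrable measurable function $\rho:\mathbb R\to\mathbb C$ with compact support. -/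

import Mathlib

open MeasureTheory Filter Asymptotics
open scoped ContDiff

/-- An admissible kernel: a smooth, positive, even function `K : ℝ → ℝ`, with `K' < 0` on `(0, ∞)`,
such that, for some `ε > 0`, every derivative satisfies
`K⁽ⁿ⁾(t) = O(exp (-|t| ^ (2 + ε)))` as `t → ∞`. -/
structure IsAdmissibleKernel (K : ℝ → ℝ) : Prop where
  smooth : ContDiff ℝ ∞ K
  pos : ∀ t : ℝ, 0 < K t
  even : ∀ t : ℝ, K (-t) = K t
  deriv_neg : ∀ t : ℝ, 0 < t → deriv K t < 0
  decay : ∃ ε : ℝ, 0 < ε ∧ ∀ n : ℕ,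
    iteratedDeriv n K =O[atTop] fun t : ℝ => Real.exp (-|t| ^ (2 + ε))

/-- `φ` is strictly logarithmically concave for `t > 0`: `(log φ)'' < 0` on `(0, ∞)`. -/
def IsStrictlyLogConcave (φ : ℝ → ℝ) : Prop :=
  ∀ t : ℝ, 0 < t → iteratedDeriv 2 (fun u : ℝ => Real.log (φ u)) t < 0

/-- The transform `F(z) = ∫ e^{itz} φ(t) dt`, as a function of a complex variable. -/
noncomputable def kernelTransform (φ : ℝ → ℝ) (z : ℂ) : ℂ :=
  ∫ t : ℝ, Complex.exp (Complex.I * (t : ℂ) * z) * (φ t : ℂ)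

/-- The associated kernel `K_n(t) = ∫ φ(s + t) φ(s - t) s^{2n} ds`. -/
noncomputable def associatedKernel (φ : ℝ → ℝ) (n : ℕ) (t : ℝ) : ℝ :=
  ∫ s : ℝ, φ (s + t) * φ (s - t) * s ^ (2 * n)

/-- The generalized real Laguerre expression
`L_n(x; f) = ∑_{j = 0}^{2n} (-1)^{j+n} / (2n)! * binom(2n, j) * f⁽ʲ⁾(x) f⁽²ⁿ⁻ʲ⁾(x)`
of an entire function `f`, at a real point `x`. -/
noncomputable def laguerreExpression (n : ℕ) (f : ℂ → ℂ) (x : ℝ) : ℂ :=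
  ∑ j ∈ Finset.range (2 * n + 1),
    (-1 : ℂ) ^ (j + n) / (Nat.factorial (2 * n) : ℂ) * (Nat.choose (2 * n) j : ℂ)
      * iteratedDeriv j f (x : ℂ) * iteratedDeriv (2 * n - j) f (x : ℂ)

/-- A real entire function: entire, and real on the real axis. -/
def IsRealEntire (f : ℂ → ℂ) : Prop :=
  Differentiable ℂ f ∧ ∀ x : ℝ, (f (x : ℂ)).im = 0

/-- The Laguerre–Pólya class: real entire functions of the form
`f(z) = C e^{-a z² + b z} z^m ∏ₖ (1 - z / zₖ) e^{z / zₖ}` with `C, b` real, `a ≥ 0`, and finitely or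
infinitely many real zeros `zₖ ≠ 0` with `∑ 1 / zₖ² < ∞`. Here `w k` is the reciprocal `1 / zₖ`;
`w k = 0` stands for `zₖ = ∞`, that is, for an absent factor. `P` is the canonical product. -/
def IsLaguerrePolya (f : ℂ → ℂ) : Prop :=
  IsRealEntire f ∧
  ∃ (C a b : ℝ) (m : ℕ) (w : ℕ → ℝ) (P : ℂ → ℂ),
    0 ≤ a ∧
    Summable (fun k => w k ^ 2) ∧
    (∀ z : ℂ, HasProd (fun k => (1 - z * (w k : ℂ)) * Complex.exp (z * (w k : ℂ))) (P z)) ∧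
    ∀ z : ℂ, f z = (C : ℂ) * Complex.exp (-(a : ℂ) * z ^ 2 + (b : ℂ) * z) * z ^ m * P z

/-- A positive definite (that is, non-negative definite) function: a continuous `φ : ℝ → ℝ` with
`∫ ∫ φ(t - s) ρ(t) conj(ρ(s)) dt ds ≥ 0` (real and non-negative) for all measurable `ρ : ℝ → ℂ` of
compact support; `ρ` is taken to be integrable, so that the double integral converges. -/
def IsPositiveDefiniteKernel (φ : ℝ → ℝ) : Prop :=
  Continuous φ ∧
  ∀ ρ : ℝ → ℂ, Measurable ρ → HasCompactSupport ρ → Integrable ρ →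
    0 ≤ (∫ s : ℝ, ∫ t : ℝ, (φ (t - s) : ℂ) * ρ t * (starRingEnd ℂ) (ρ s)).re ∧
    (∫ s : ℝ, ∫ t : ℝ, (φ (t - s) : ℂ) * ρ t * (starRingEnd ℂ) (ρ s)).im = 0

/-!
# The Laguerre–Pólya class and positive definiteness of the associated kernels

For an entire function `f` and real `x`, Taylor's formula at `x` gives
`f (x + iy) * f (x - iy) = ∑ Lₙ(x; f) y ^ (2 n)` (`hasSum_laguerreExpression`); for a real entire
function and real `y` the left-hand side is `|f (x + iy)| ^ 2`. The argument has two halves, linked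
by the condition that all `Lₙ(x; f)` are non-negative (`HasNonnegLaguerre`).

*Laguerre–Pólya class.* The generating function is multiplicative in `f`, so non-negativity is
preserved by products and by locally uniform limits; it holds for each factor of a Laguerre–Pólya
function, hence for all such functions (`IsLaguerrePolya.hasNonnegLaguerre`). Conversely, if the
transform `F` has non-negative Laguerre expressions, a zero `x + iy` with `y ≠ 0` forces every
`Lₙ(x; F)` to vanish, and then `F` vanishes identically, whereas `F 0 = ∫ φ > 0`. So the zeros are
real (`HasNonnegLaguerre.im_eq_zero`). Since `φ` decays faster than any Gaussian, `F` is
`O(exp (δ |z| ^ 2))` for every `δ > 0`, and Hadamard's factorization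
(`exists_hasProd_of_real_zeros`) writes `F` as a canonical product of genus one. That factorization
is obtained by dividing out the zeros in a disk of radius `R` and estimating the logarithm of the
quotient with the Borel–Carathéodory theorem. The realness of the zeros gives the square
summability of their reciprocals from the value of the partial products at `z = i`.

*Positive definiteness.* Writing the derivatives of `F` as integrals, the alternating binomial sum in
`Lₙ(x; F)` becomes the double integral of `(v - u) ^ (2 n) φ(u) φ(v) exp (i (u + v) x) / (2 n)!`, and
the substitution `(u, v) = (t - s, t + s)` turns it into a positive multiple of the cosine transform
of `Kₙ` (`IsAdmissibleKernel.laguerreExpression_kernelTransform`). The cosine transform of a positive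
definite integrable function is non-negative
(`IsPositiveDefiniteKernel.integral_mul_cos_nonneg`). Conversely, the transform of `Kₙ` is integrable,
because `F` and its derivatives restrict to Schwartz functions on the real line, so Fourier inversion
shows that `Kₙ` is the Fourier transform of a non-negative integrable function, hence positive definite
(`isPositiveDefiniteKernel_of_eq_integral`).
-/

open scoped ComplexOrder Topology

/-! ### Laguerre expressions as Taylor coefficients -/

/-- The Laguerre expressions of `f` at `x` are the Taylor coefficients, in powers of `y ^ 2`, of the
even entire function `f (x + iy) f (x - iy)` of `y`. -/
theorem hasSum_laguerreExpression {f : ℂ → ℂ} (hf : Differentiable ℂ f) (x : ℝ) (y : ℂ) :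
    HasSum (fun n => laguerreExpression n f x * y ^ (2 * n))
      (f (x + Complex.I * y) * f (x - Complex.I * y)) := by
  have hc : ∀ c : ℂ, ∀ m : ℕ, iteratedDeriv m (fun y : ℂ => f (x + c * y)) 0
      = c ^ m * iteratedDeriv m f x := by
    intro c m
    have h1 := iteratedDeriv_comp_const_mul (n := m) (f := fun u => f (x + u))
      (Differentiable.contDiff (by fun_prop)) c
    rw [h1, iteratedDeriv_comp_const_add]
    simp
  have hψ : Differentiable ℂ (fun y : ℂ => f (x + Complex.I * y) * f (x + -Complex.I * y)) := by
    fun_prop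
  have hder : ∀ m : ℕ,
      iteratedDeriv m (fun y : ℂ => f (x + Complex.I * y) * f (x + -Complex.I * y)) 0
      = ∑ j ∈ Finset.range (m + 1), (m.choose j : ℂ) * (Complex.I ^ j * iteratedDeriv j f x)
          * ((-Complex.I) ^ (m - j) * iteratedDeriv (m - j) f x) := by
    intro m
    rw [iteratedDeriv_fun_mul (Differentiable.contDiff (by fun_prop)).contDiffAt
      (Differentiable.contDiff (by fun_prop)).contDiffAt]
    simp only [hc]
  have hT := Complex.hasSum_taylorSeries_of_entire hψ 0 y
  have hinj : Function.Injective (fun n : ℕ => 2 * n) := fun a b h => by simpa using h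
  rw [← hinj.hasSum_iff] at hT
  · have hcoef : ∀ n, laguerreExpression n f x * y ^ (2 * n) = ((2 * n).factorial : ℂ)⁻¹ •
        (y - 0) ^ (2 * n) • iteratedDeriv (2 * n)
          (fun y : ℂ => f (x + Complex.I * y) * f (x + -Complex.I * y)) 0 := by
      intro n
      simp only [hder, sub_zero, smul_eq_mul, laguerreExpression, Finset.sum_mul,
        Finset.mul_sum]
      refine Finset.sum_congr rfl fun j hj => ?_
      have hj' : j ≤ 2 * n := by simpa [Nat.lt_succ_iff] using hj
      -- `i ^ j (-i) ^ (2n - j) = (-1) ^ (j + n)`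
      have hI : Complex.I ^ j * (-Complex.I) ^ (2 * n - j) = (-1) ^ (j + n) := by
        obtain ⟨k, hk⟩ := Nat.exists_eq_add_of_le hj'
        rw [hk, Nat.add_sub_cancel_left, neg_pow, mul_left_comm, ← pow_add, ← hk, pow_mul,
          Complex.I_sq, pow_add (-1 : ℂ) j n]
        congr 1
        have : (-1 : ℂ) ^ (j + k) = 1 := by rw [← hk, pow_mul]; simp
        rw [pow_add] at this
        have h2 : ((-1 : ℂ) ^ j) * (-1) ^ j = 1 := by rw [← mul_pow]; simp
        linear_combination (-1 : ℂ) ^ j * this - (-1 : ℂ) ^ k * h2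
      rw [← hI]
      ring
    rw [sub_eq_add_neg, ← neg_mul, funext hcoef]
    exact hT
  · intro m hm
    -- the odd Taylor coefficients of an even function vanish
    have hodd : Odd m := by
      rcases Nat.even_or_odd m with h | h
      · obtain ⟨k, hk⟩ := h
        exact absurd ⟨k, by simp only; omega⟩ hm
      · exact h
    have h1 := iteratedDeriv_comp_neg m
      (fun y : ℂ => f (x + Complex.I * y) * f (x + -Complex.I * y)) 0
    have h2 : (fun y : ℂ => (fun y : ℂ => f (x + Complex.I * y) * f (x + -Complex.I * y)) (-y))
        = (fun y : ℂ => f (x + Complex.I * y) * f (x + -Complex.I * y)) := by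
      funext y
      simp only [mul_neg, neg_mul, neg_neg]
      ring
    rw [h2, neg_zero, hodd.neg_one_pow, smul_eq_mul, neg_one_mul] at h1
    rw [self_eq_neg.mp h1]
    simp

/-- Uniqueness of the coefficients of a power series in `y ^ 2`. -/
theorem eq_zero_of_hasSum_mul_pow_two_mul {d : ℕ → ℂ}
    (h : ∀ y : ℂ, HasSum (fun n => d n * y ^ (2 * n)) 0) : d = 0 := by
  have hp : HasFPowerSeriesAt (fun _ : ℂ => (0 : ℂ)) (FormalMultilinearSeries.ofScalars ℂ d) 0 := by
    rw [hasFPowerSeriesAt_iff]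
    refine Eventually.of_forall fun t => ?_
    obtain ⟨y, hy⟩ := IsAlgClosed.exists_pow_nat_eq t two_pos
    have hcoef : ∀ n, t ^ n • (FormalMultilinearSeries.ofScalars ℂ d).coeff n
        = d n * y ^ (2 * n) := by
      intro n
      rw [FormalMultilinearSeries.coeff_ofScalars, pow_mul, hy, smul_eq_mul, mul_comm]
    rw [funext hcoef]
    exact h y
  have := hp.eq_zero
  funext n
  rw [← FormalMultilinearSeries.coeff_ofScalars (𝕜 := ℂ) (p := d) (n := n), this]
  rfl

theorem eq_laguerreExpression {f : ℂ → ℂ} (hf : Differentiable ℂ f) {x : ℝ} {c : ℕ → ℂ}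
    (h : ∀ y : ℂ, HasSum (fun n => c n * y ^ (2 * n))
      (f (x + Complex.I * y) * f (x - Complex.I * y))) (n : ℕ) :
    laguerreExpression n f x = c n := by
  have := eq_zero_of_hasSum_mul_pow_two_mul (d := fun n => laguerreExpression n f x - c n)
    fun y => by simpa [sub_mul] using (hasSum_laguerreExpression hf x y).sub (h y)
  exact sub_eq_zero.mp (congrFun this n)

/-- The generating function `f (x + iy) f (x - iy)` is multiplicative in `f`, so that the Laguerre
expressions of a product form the Cauchy product of those of the factors. -/
theorem laguerreExpression_mul {f g : ℂ → ℂ} (hf : Differentiable ℂ f) (hg : Differentiable ℂ g)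
    (n : ℕ) (x : ℝ) :
    laguerreExpression n (fun z => f z * g z) x =
      ∑ p ∈ Finset.HasAntidiagonal.antidiagonal n,
        laguerreExpression p.1 f x * laguerreExpression p.2 g x := by
  refine eq_laguerreExpression (f := fun z => f z * g z) (by fun_prop)
    (c := fun n => ∑ p ∈ Finset.HasAntidiagonal.antidiagonal n,
      laguerreExpression p.1 f x * laguerreExpression p.2 g x) (fun y => ?_) n
  have h1 := hasSum_laguerreExpression hf x y
  have h2 := hasSum_laguerreExpression hg x y
  have h3 := summable_norm_sum_mul_antidiagonal_of_summable_norm h1.summable.norm h2.summable.norm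
  have h4 := tsum_mul_tsum_eq_tsum_sum_antidiagonal_of_summable_norm h1.summable.norm
    h2.summable.norm
  have h5 := h3.of_norm.hasSum
  rw [← h4, h1.tsum_eq, h2.tsum_eq] at h5
  rw [mul_mul_mul_comm] at h5
  have hcoef : ∀ n, (∑ p ∈ Finset.HasAntidiagonal.antidiagonal n,
      laguerreExpression p.1 f x * laguerreExpression p.2 g x) * y ^ (2 * n) =
      ∑ p ∈ Finset.HasAntidiagonal.antidiagonal n,
        laguerreExpression p.1 f x * y ^ (2 * p.1) *
          (laguerreExpression p.2 g x * y ^ (2 * p.2)) := by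
    intro n
    rw [Finset.sum_mul]
    refine Finset.sum_congr rfl fun p hp => ?_
    rw [← Finset.HasAntidiagonal.mem_antidiagonal.mp hp]
    ring
  rw [funext hcoef]
  exact h5

theorem tendsto_laguerreExpression {ι : Type*} {l : Filter ι} [l.NeBot] {F : ι → ℂ → ℂ} {f : ℂ → ℂ}
    (h : TendstoLocallyUniformlyOn F f l Set.univ) (hF : ∀ i, Differentiable ℂ (F i))
    (n : ℕ) (x : ℝ) :
    Tendsto (fun i => laguerreExpression n (F i) x) l (𝓝 (laguerreExpression n f x)) := by
  have key : ∀ j : ℕ, TendstoLocallyUniformlyOn (fun i => iteratedDeriv j (F i))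
      (iteratedDeriv j f) l Set.univ ∧ ∀ i, Differentiable ℂ (iteratedDeriv j (F i)) := by
    intro j
    induction j with
    | zero => simpa using ⟨h, hF⟩
    | succ j ih =>
      constructor
      · have := ih.1.deriv (Eventually.of_forall fun i => (ih.2 i).differentiableOn) isOpen_univ
        simp only [iteratedDeriv_succ]
        exact this
      · intro i
        rw [iteratedDeriv_succ]
        exact fun z => ((ih.2 i).analyticAt z).deriv.differentiableAt
  have hpt : ∀ j, Tendsto (fun i => iteratedDeriv j (F i) x) l (𝓝 (iteratedDeriv j f x)) :=
    fun j => (key j).1.tendsto_at (Set.mem_univ _)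
  unfold laguerreExpression
  exact tendsto_finsetSum _ fun j _ => (((hpt j).const_mul _).mul (hpt _))

/-! ### Laguerre–Pólya functions have non-negative Laguerre expressions -/

/-- An entire function all of whose generalized Laguerre expressions are non-negative on the real
axis. In the order on `ℂ` of the scope `ComplexOrder`, `0 ≤ w` includes that `w` is real. -/
def HasNonnegLaguerre (f : ℂ → ℂ) : Prop :=
  Differentiable ℂ f ∧ ∀ (n : ℕ) (x : ℝ), 0 ≤ laguerreExpression n f x

namespace HasNonnegLaguerre

theorem of_hasSum {f : ℂ → ℂ} (hf : Differentiable ℂ f) (c : ℝ → ℕ → ℝ) (hc : ∀ x n, 0 ≤ c x n)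
    (h : ∀ (x : ℝ) (y : ℂ), HasSum (fun n => (c x n : ℂ) * y ^ (2 * n))
      (f (x + Complex.I * y) * f (x - Complex.I * y))) : HasNonnegLaguerre f := by
  refine ⟨hf, fun n x => ?_⟩
  rw [eq_laguerreExpression hf (c := fun n => (c x n : ℂ)) (h x) n]
  exact_mod_cast hc x n

theorem mul {f g : ℂ → ℂ} (hf : HasNonnegLaguerre f) (hg : HasNonnegLaguerre g) :
    HasNonnegLaguerre (fun z => f z * g z) := by
  refine ⟨hf.1.mul hg.1, fun n x => ?_⟩
  rw [laguerreExpression_mul hf.1 hg.1]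
  exact Finset.sum_nonneg fun p _ => mul_nonneg (hf.2 _ _) (hg.2 _ _)

/-- For `f z = α - β z` the generating function is `(α - β x) ^ 2 + β ^ 2 y ^ 2`. -/
theorem linear (α β : ℝ) : HasNonnegLaguerre (fun z => α - β * z) := by
  refine of_hasSum (by fun_prop)
    (fun x n => if n = 0 then (α - β * x) ^ 2 else if n = 1 then β ^ 2 else 0)
    (fun x n => by split_ifs <;> positivity) fun x y => ?_
  have hz : ∀ n ∉ Finset.range 2, (((if n = 0 then (α - β * x) ^ 2 else
      if n = 1 then β ^ 2 else 0 : ℝ) : ℝ) : ℂ) * y ^ (2 * n) = 0 := by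
    intro n hn
    have : 2 ≤ n := by simpa [Nat.lt_iff_add_one_le] using hn
    rw [if_neg (by omega), if_neg (by omega)]
    simp
  have hv : ((α : ℂ) - β * (x + Complex.I * y)) * (α - β * (x - Complex.I * y))
    = ∑ n ∈ Finset.range 2, (((if n = 0 then (α - β * x) ^ 2 else
      if n = 1 then β ^ 2 else 0 : ℝ) : ℝ) : ℂ) * y ^ (2 * n) := by
    simp only [Finset.sum_range_succ, Finset.sum_range_zero, if_true, one_ne_zero, if_false]
    push_cast
    linear_combination -(β : ℂ) ^ 2 * y ^ 2 * Complex.I_sq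
  rw [hv]
  exact hasSum_sum_of_ne_finset_zero hz

theorem const (C : ℝ) : HasNonnegLaguerre (fun _ => (C : ℂ)) := by
  simpa using linear C 0

/-- For `f z = exp (-a z ^ 2 + b z)` the generating function is
`exp (-2 a x ^ 2 + 2 b x) exp (2 a y ^ 2)`. -/
theorem exp_quadratic {a : ℝ} (ha : 0 ≤ a) (b : ℝ) :
    HasNonnegLaguerre (fun z => Complex.exp (-(a : ℂ) * z ^ 2 + (b : ℂ) * z)) := by
  refine of_hasSum (by fun_prop)
    (fun x n => Real.exp (-2 * a * x ^ 2 + 2 * b * x) * ((2 * a) ^ n / n.factorial))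
    (fun x n => by positivity) fun x y => ?_
  have h := (NormedSpace.expSeries_div_hasSum_exp (2 * (a : ℂ) * y ^ 2)).mul_left
    (Complex.exp (-2 * a * x ^ 2 + 2 * b * x))
  rw [← Complex.exp_eq_exp_ℂ, ← Complex.exp_add] at h
  rw [← Complex.exp_add, show -(a : ℂ) * (x + Complex.I * y) ^ 2 + b * (x + Complex.I * y) +
    (-(a : ℂ) * (x - Complex.I * y) ^ 2 + b * (x - Complex.I * y)) =
    -2 * a * x ^ 2 + 2 * b * x + 2 * a * y ^ 2 by
      linear_combination -2 * (a : ℂ) * y ^ 2 * Complex.I_sq]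
  have hcoef : ∀ n : ℕ, ((Real.exp (-2 * a * x ^ 2 + 2 * b * x) *
      ((2 * a) ^ n / n.factorial) : ℝ) : ℂ) * y ^ (2 * n) =
      Complex.exp (-2 * a * x ^ 2 + 2 * b * x) * ((2 * (a : ℂ) * y ^ 2) ^ n / n.factorial) := by
    intro n
    push_cast
    ring
  rw [funext hcoef]
  exact h

theorem pow (m : ℕ) : HasNonnegLaguerre (fun z => z ^ m) := by
  induction m with
  | zero => simpa using const 1
  | succ m ih => simpa [pow_succ] using ih.mul (by simpa using linear 0 (-1))

theorem finset_prod {ι : Type*} (s : Finset ι) {f : ι → ℂ → ℂ}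
    (hf : ∀ i ∈ s, HasNonnegLaguerre (f i)) : HasNonnegLaguerre (fun z => ∏ i ∈ s, f i z) := by
  classical
  induction s using Finset.induction_on with
  | empty => simpa using const 1
  | insert i s hi ih =>
    simp only [Finset.prod_insert hi]
    exact (hf i (by simp)).mul (ih fun j hj => hf j (by simp [hj]))

theorem of_tendstoLocallyUniformlyOn {ι : Type*} {l : Filter ι} [l.NeBot] {F : ι → ℂ → ℂ}
    {f : ℂ → ℂ} (h : TendstoLocallyUniformlyOn F f l Set.univ)
    (hF : ∀ i, HasNonnegLaguerre (F i)) : HasNonnegLaguerre f := by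
  constructor
  · rw [← differentiableOn_univ]
    exact h.differentiableOn (Eventually.of_forall fun i => (hF i).1.differentiableOn) isOpen_univ
  · intro n x
    exact ge_of_tendsto' (tendsto_laguerreExpression h (fun i => (hF i).1) n x)
      fun i => (hF i).2 n x

end HasNonnegLaguerre

theorem norm_one_sub_mul_exp_sub_one_le {u : ℂ} (hu : ‖u‖ ≤ 1) :
    ‖(1 - u) * Complex.exp u - 1‖ ≤ 3 * ‖u‖ ^ 2 := by
  have h1 := Complex.norm_exp_sub_one_sub_id_le hu
  have h2 := Complex.norm_exp_sub_one_le hu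
  calc ‖(1 - u) * Complex.exp u - 1‖
      = ‖(Complex.exp u - 1 - u) - u * (Complex.exp u - 1)‖ := by congr 1; ring
    _ ≤ ‖Complex.exp u - 1 - u‖ + ‖u‖ * ‖Complex.exp u - 1‖ := by
        rw [← norm_mul]; exact norm_sub_le _ _
    _ ≤ ‖u‖ ^ 2 + ‖u‖ * (2 * ‖u‖) := by gcongr
    _ = 3 * ‖u‖ ^ 2 := by ring

/-- Square summability of `w` makes the genus one canonical product with factors
`(1 - z wₖ) exp (z wₖ)` converge locally uniformly. -/
theorem hasProdLocallyUniformlyOn_canonicalProduct {ι : Type*} {w : ι → ℂ}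
    (hw : Summable fun k => ‖w k‖ ^ 2) (R : ℝ) :
    HasProdLocallyUniformlyOn (fun k z => (1 - z * w k) * Complex.exp (z * w k))
      (fun z => ∏' k, (1 - z * w k) * Complex.exp (z * w k)) (Metric.ball (0 : ℂ) R) := by
  have hsmall : ∀ᶠ k in cofinite, R ^ 2 * ‖w k‖ ^ 2 < 1 := by
    have := (hw.mul_left (R ^ 2)).tendsto_cofinite_zero
    exact this.eventually (gt_mem_nhds one_pos)
  have h := Summable.hasProdLocallyUniformlyOn_one_add (R := ℂ)
    (f := fun k z => (1 - z * w k) * Complex.exp (z * w k) - 1)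
    (Metric.isOpen_ball (x := (0 : ℂ)) (ε := R)) (hw.mul_left (3 * R ^ 2)) ?_ ?_
  · simpa using h
  · filter_upwards [hsmall] with k hk z hz
    have hz' : ‖z‖ < R := by simpa using hz
    have hzw : ‖z * w k‖ ^ 2 ≤ R ^ 2 * ‖w k‖ ^ 2 := by
      rw [norm_mul, mul_pow]
      gcongr
    refine (norm_one_sub_mul_exp_sub_one_le ?_).trans ?_
    · nlinarith [norm_nonneg (z * w k)]
    · linarith
  · intro k
    fun_prop

theorem IsLaguerrePolya.hasNonnegLaguerre {f : ℂ → ℂ} (hf : IsLaguerrePolya f) :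
    HasNonnegLaguerre f := by
  obtain ⟨-, C, a, b, m, w, P, ha, hw, hP, hfP⟩ := hf
  have hw' : Summable fun k => ‖(w k : ℂ)‖ ^ 2 := by simpa using hw
  have hPnn : HasNonnegLaguerre P := by
    have hPt : P = fun z => ∏' k, (1 - z * (w k : ℂ)) * Complex.exp (z * (w k : ℂ)) :=
      funext fun z => (hP z).tprod_eq.symm
    have hloc : TendstoLocallyUniformlyOn
        (fun (s : Finset ℕ) z => ∏ k ∈ s, (1 - z * (w k : ℂ)) * Complex.exp (z * (w k : ℂ)))
        P atTop Set.univ := by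
      rw [tendstoLocallyUniformlyOn_iff_forall_isCompact isOpen_univ]
      intro K _ hK
      obtain ⟨R, hR⟩ := hK.isBounded.subset_ball 0
      have := hasProdLocallyUniformlyOn_canonicalProduct hw' R
      rw [hasProdLocallyUniformlyOn_iff_tendstoLocallyUniformlyOn,
        tendstoLocallyUniformlyOn_iff_forall_isCompact Metric.isOpen_ball] at this
      rw [hPt]
      exact this K hR hK
    refine .of_tendstoLocallyUniformlyOn hloc fun s => .finset_prod s fun k _ => ?_
    have h1 := (HasNonnegLaguerre.linear 1 (w k)).mul
      (HasNonnegLaguerre.exp_quadratic le_rfl (w k))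
    simpa [mul_comm] using h1
  have h := (((HasNonnegLaguerre.const C).mul (.exp_quadratic ha b)).mul (.pow m)).mul hPnn
  rwa [← funext hfP] at h

/-! ### Hadamard's factorization -/

theorem finite_zeros_inter_ball {f : ℂ → ℂ} (hf : Differentiable ℂ f) {x : ℂ} (hx : f x ≠ 0)
    (R : ℝ) : {a | f a = 0 ∧ ‖a‖ < R}.Finite := by
  have h1 := AnalyticOnNhd.preimage_zero_mem_codiscrete (f := f) (fun z _ => hf.analyticAt z) hx
  rw [mem_codiscrete'] at h1
  have h2 : (f ⁻¹' {0}ᶜ)ᶜ = {a | f a = 0} := by ext; simp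
  rw [h2] at h1
  have hcl : IsClosed {a | f a = 0} := isClosed_eq hf.continuous continuous_const
  have hcomp : IsCompact ({a | f a = 0} ∩ Metric.closedBall 0 R) :=
    (isCompact_closedBall (0 : ℂ) R).inter_left hcl
  refine (hcomp.finite (h1.2.mono Set.inter_subset_left)).subset fun a ha => ⟨ha.1, ?_⟩
  simpa using ha.2.le

/-- Dividing out a zero of an entire function, with its multiplicity. -/
theorem exists_entire_eq_pow_mul {g : ℂ → ℂ} (hg : Differentiable ℂ g) {a : ℂ}
    (ha : a ≠ 0) (hord : analyticOrderAt g a ≠ ⊤) :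
    ∃ h : ℂ → ℂ, Differentiable ℂ h ∧ h a ≠ 0 ∧
      ∀ z, g z = (1 - z / a) ^ analyticOrderNatAt g a * h z := by
  set m := analyticOrderNatAt g a with hm
  obtain ⟨h₀, hh₀, hne, heq⟩ :=
    ((hg.analyticAt a).analyticOrderNatAt_eq_iff hord (n := m)).mp rfl
  have hlin : ∀ z : ℂ, z ≠ a → (1 - z / a) ≠ 0 := by
    exact fun z hz h => hz ((div_eq_one_iff_eq ha).mp (sub_eq_zero.mp h).symm)
  refine ⟨Function.update (fun z => g z / (1 - z / a) ^ m) a ((-a) ^ m * h₀ a), ?_, ?_, ?_⟩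
  · intro z
    by_cases hz : z = a
    · subst hz
      have : (fun w => (-z) ^ m * h₀ w) =ᶠ[𝓝 z]
          Function.update (fun w => g w / (1 - w / z) ^ m) z ((-z) ^ m * h₀ z) := by
        filter_upwards [heq] with w hw
        by_cases hwz : w = z
        · simp [hwz]
        · rw [Function.update_of_ne hwz, hw, eq_div_iff (pow_ne_zero _ (hlin w hwz)), smul_eq_mul,
            mul_right_comm, ← mul_pow]
          congr 2
          field_simp
          ring
      exact (hh₀.differentiableAt.const_mul _).congr_of_eventuallyEq this.symm
    · have : (fun w => g w / (1 - w / a) ^ m) =ᶠ[𝓝 z]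
          Function.update (fun w => g w / (1 - w / a) ^ m) a ((-a) ^ m * h₀ a) := by
        filter_upwards [isOpen_ne.mem_nhds hz] with w hw
        rw [Function.update_of_ne hw]
      refine DifferentiableAt.congr_of_eventuallyEq ?_ this.symm
      exact (hg z).div (by fun_prop) (pow_ne_zero _ (hlin z hz))
  · simpa using ⟨fun h => absurd h ha, hne⟩
  · intro z
    by_cases hz : z = a
    · subst hz
      rw [Function.update_self, div_self ha, sub_self, heq.self_of_nhds, smul_eq_mul, sub_self]
      rcases Nat.eq_zero_or_pos m with h | h
      · simp [h]
      · simp [h.ne']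
    · rw [Function.update_of_ne hz, mul_div_cancel₀ _ (pow_ne_zero _ (hlin z hz))]

/-- Dividing out a finite set of zeros of an entire function, each with its full multiplicity. The
factors are normalized to be `1` at the origin. -/
theorem exists_entire_eq_prod_mul {f : ℂ → ℂ} (hf : Differentiable ℂ f)
    (hord : ∀ a, analyticOrderAt f a ≠ ⊤) (S : Finset ℂ) (hS : ∀ a ∈ S, a ≠ 0) :
    ∃ g : ℂ → ℂ, Differentiable ℂ g ∧ (∀ a ∈ S, g a ≠ 0) ∧
      ∀ z, f z = (∏ a ∈ S, (1 - z / a) ^ analyticOrderNatAt f a) * g z := by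
  classical
  induction S using Finset.induction_on with
  | empty => exact ⟨f, hf, by simp, by simp⟩
  | insert b S hb ih =>
    obtain ⟨g, hg, hgS, hfg⟩ := ih fun a ha => hS a (by simp [ha])
    have hb0 : b ≠ 0 := hS b (by simp)
    set P : ℂ → ℂ := fun z => ∏ a ∈ S, (1 - z / a) ^ analyticOrderNatAt f a with hP
    have hPd : Differentiable ℂ P := by
      rw [hP]
      fun_prop
    have hPb : P b ≠ 0 := by
      refine Finset.prod_ne_zero_iff.mpr fun a ha => pow_ne_zero _ fun h => ?_
      have ha0 : a ≠ 0 := hS a (by simp [ha])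
      exact hb ((div_eq_one_iff_eq ha0).mp (sub_eq_zero.mp h).symm ▸ ha)
    have hfP : f = P * g := funext hfg
    -- the factor `P` does not vanish at `b`, so `f` and `g` have the same order there
    have hordb : analyticOrderAt f b = analyticOrderAt g b := by
      rw [hfP, analyticOrderAt_mul (hPd.analyticAt b) (hg.analyticAt b),
        (hPd.analyticAt b).analyticOrderAt_eq_zero.mpr hPb, zero_add]
    obtain ⟨h, hh, hhb, hgh⟩ := exists_entire_eq_pow_mul hg hb0 (hordb ▸ hord b)
    refine ⟨h, hh, ?_, fun z => ?_⟩
    · intro a ha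
      rcases Finset.mem_insert.mp ha with rfl | ha
      · exact hhb
      · intro h0
        exact hgS a ha (by rw [hgh, h0, mul_zero])
    · have : analyticOrderNatAt f b = analyticOrderNatAt g b := by
        simp [analyticOrderNatAt, hordb]
      rw [Finset.prod_insert hb, hfg z, hgh z, this]
      ring

/-- A zero-free holomorphic function on a disk has a holomorphic logarithm. -/
theorem exists_log_of_ne_zero_on_ball {g : ℂ → ℂ} {R : ℝ} (hR : 0 < R) (hg : Differentiable ℂ g)
    (hne : ∀ z ∈ Metric.ball (0 : ℂ) R, g z ≠ 0) (h0 : g 0 = 1) :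
    ∃ h : ℂ → ℂ, DifferentiableOn ℂ h (Metric.ball 0 R) ∧ h 0 = 0 ∧
      ∀ z ∈ Metric.ball (0 : ℂ) R, Complex.exp (h z) = g z := by
  have hu : DifferentiableOn ℂ (fun z => deriv g z / g z) (Metric.ball 0 R) := by
    refine DifferentiableOn.div ?_ hg.differentiableOn hne
    exact fun z _ => (hg.analyticAt z).deriv.differentiableAt.differentiableWithinAt
  obtain ⟨h, hh0, hh⟩ := hu.isExactOn_ball.with_val_at 0 0
  have hd : DifferentiableOn ℂ h (Metric.ball 0 R) :=
    fun z hz => (hh z hz).differentiableAt.differentiableWithinAt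
  refine ⟨h, hd, hh0, fun z hz => ?_⟩
  have hconst : ∀ w ∈ Metric.ball (0 : ℂ) R,
      HasDerivAt (fun w => g w * Complex.exp (-h w)) 0 w := by
    intro w hw
    have h1 := (hg w).hasDerivAt.fun_mul (hh w hw).fun_neg.cexp
    refine h1.congr_deriv ?_
    have := hne w hw
    field_simp
    ring
  have h2 := (convex_ball (0 : ℂ) R).is_const_of_fderivWithin_eq_zero (𝕜 := ℂ)
    (f := fun w => g w * Complex.exp (-h w))
    (fun w hw => (hconst w hw).differentiableAt.differentiableWithinAt)
    (fun w hw => by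
      rw [fderivWithin_of_isOpen Metric.isOpen_ball hw]
      ext
      simp [(hconst w hw).hasFDerivAt.fderiv]) hz (Metric.mem_ball_self hR)
  simp only [hh0, h0, neg_zero, Complex.exp_zero, mul_one, Complex.exp_neg] at h2
  field_simp at h2
  exact h2.symm

/-- A second-order Schwarz lemma: the Taylor remainder of order two of a bounded holomorphic
function on a disk is quadratically small. -/
theorem norm_sub_deriv_mul_le {h : ℂ → ℂ} {r B : ℝ} (hr : 0 < r)
    (hd : DifferentiableOn ℂ h (Metric.ball 0 r)) (h0 : h 0 = 0)
    (hB : ∀ z ∈ Metric.ball (0 : ℂ) r, ‖h z‖ ≤ B) {z : ℂ} (hz : z ∈ Metric.ball (0 : ℂ) r) :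
    ‖h z - deriv h 0 * z‖ ≤ 2 * B / r ^ 2 * ‖z‖ ^ 2 := by
  have hnhds : Metric.ball (0 : ℂ) r ∈ 𝓝 (0 : ℂ) := Metric.ball_mem_nhds _ hr
  have h1 : ∀ w ∈ Metric.ball (0 : ℂ) r, ‖dslope h 0 w‖ ≤ B / r := fun w hw =>
    Complex.norm_dslope_le_div_of_mapsTo_ball hd (fun v hv => by simpa [h0] using hB v hv) hw
  have hd1 : DifferentiableOn ℂ (dslope h 0) (Metric.ball 0 r) :=
    (Complex.differentiableOn_dslope hnhds).mpr hd
  have h2 : ‖dslope (dslope h 0) 0 z‖ ≤ (2 * B / r) / r := by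
    refine Complex.norm_dslope_le_div_of_mapsTo_ball hd1 (fun v hv => ?_) hz
    rw [mem_closedBall_iff_norm]
    calc _ ≤ B / r + B / r :=
          (norm_sub_le _ _).trans (add_le_add (h1 v hv) (h1 0 (Metric.mem_ball_self hr)))
      _ = 2 * B / r := by ring
  have e1 : h z = z * dslope h 0 z := by
    simpa [h0] using (sub_smul_dslope h 0 z).symm
  have e2 : dslope h 0 z - deriv h 0 = z * dslope (dslope h 0) 0 z := by
    simpa using (sub_smul_dslope (dslope h 0) 0 z).symm
  have e3 : h z - deriv h 0 * z = z ^ 2 * dslope (dslope h 0) 0 z := by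
    rw [e1]
    linear_combination z * e2
  rw [e3, norm_mul, norm_pow, mul_comm]
  calc _ ≤ (2 * B / r) / r * ‖z‖ ^ 2 := by gcongr
    _ = _ := by ring

theorem hasDerivAt_prod_one_sub_div_pow (S : Finset ℂ) (m : ℂ → ℕ) :
    HasDerivAt (fun z : ℂ => ∏ a ∈ S, (1 - z / a) ^ m a) (-∑ a ∈ S, m a / a) 0 := by
  classical
  induction S using Finset.induction_on with
  | empty => simpa using hasDerivAt_const (0 : ℂ) (1 : ℂ)
  | insert b S hb ih =>
    simp only [Finset.prod_insert hb, Finset.sum_insert hb]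
    have h1 : HasDerivAt (fun z : ℂ => (1 - z / b) ^ m b) (-(m b / b)) 0 := by
      have := (((hasDerivAt_id (0 : ℂ)).div_const b).const_sub 1).fun_pow (m b)
      refine this.congr_deriv ?_
      simp
      ring
    have := h1.fun_mul ih
    simp only [zero_div, sub_zero, one_pow, Finset.prod_const_one, mul_one, one_mul] at this
    exact this.congr_deriv (by ring)

/-- The approximation step of Hadamard's factorization. The zeros in the disk of radius `R` are
divided out; each factor `1 - z / a` has modulus at least `1` on the circle of radius `2 * R`, so
the quotient inherits the bound of `f` there, and the Borel–Carathéodory theorem controls its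
logarithm. The linear part of that logarithm combines with `exp (z / a)`. -/
theorem exists_factorization_on_ball {f : ℂ → ℂ} (hf : Differentiable ℂ f) (h0 : f 0 = 1)
    {R M : ℝ} (hR : 0 < R) (hM : 0 < M) (hbound : ∀ z, ‖z‖ = 2 * R → ‖f z‖ ≤ Real.exp M)
    {S : Finset ℂ} (hS : ∀ a, a ∈ S ↔ f a = 0 ∧ ‖a‖ < R) {z : ℂ} (hz : ‖z‖ < R / 2) :
    ∃ e : ℂ, ‖e‖ ≤ 16 * M / R ^ 2 * ‖z‖ ^ 2 ∧
      f z = Complex.exp (deriv f 0 * z) *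
        (∏ a ∈ S, ((1 - z * a⁻¹) * Complex.exp (z * a⁻¹)) ^ analyticOrderNatAt f a) *
          Complex.exp e := by
  have hord : ∀ a, analyticOrderAt f a ≠ ⊤ := by
    intro a h
    rw [AnalyticOnNhd.analyticOrderAt_eq_top_iff_eq_zero a fun z => hf.analyticAt z] at h
    simp [h] at h0
  have hS0 : ∀ a ∈ S, a ≠ 0 := by
    rintro a ha rfl
    simpa [h0] using ((hS 0).mp ha).1
  obtain ⟨g, hg, hgS, hfg⟩ := exists_entire_eq_prod_mul hf hord S hS0
  have hg0 : g 0 = 1 := by simpa [h0] using (hfg 0).symm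
  have hgne : ∀ w ∈ Metric.ball (0 : ℂ) R, g w ≠ 0 := by
    intro w hw hgw
    have : w ∈ S := (hS w).mpr ⟨by rw [hfg, hgw, mul_zero], by simpa using hw⟩
    exact hgS w this hgw
  have hgsphere : ∀ w, ‖w‖ = 2 * R → ‖g w‖ ≤ Real.exp M := by
    intro w hw
    have h1 : 1 ≤ ‖∏ a ∈ S, (1 - w / a) ^ analyticOrderNatAt f a‖ := by
      rw [norm_prod]
      rw [← Finset.prod_const_one (s := S)]
      refine Finset.prod_le_prod (fun _ _ => zero_le_one) fun a ha => ?_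
      rw [norm_pow]
      refine one_le_pow₀ ?_
      have ha0 : 0 < ‖a‖ := norm_pos_iff.mpr (hS0 a ha)
      have h2 : 2 ≤ ‖w / a‖ := by
        rw [norm_div, hw, le_div_iff₀ ha0]
        linarith [((hS a).mp ha).2]
      have h3 := norm_sub_norm_le (w / a) 1
      rw [norm_one, norm_sub_rev] at h3
      linarith
    calc ‖g w‖ ≤ ‖∏ a ∈ S, (1 - w / a) ^ analyticOrderNatAt f a‖ * ‖g w‖ :=
          le_mul_of_one_le_left (norm_nonneg _) h1
      _ = ‖f w‖ := by rw [hfg w, norm_mul]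
      _ ≤ _ := hbound w hw
  have hgball : ∀ w ∈ Metric.ball (0 : ℂ) R, ‖g w‖ ≤ Real.exp M := by
    intro w hw
    refine Complex.norm_le_of_forall_mem_frontier_norm_le (U := Metric.ball (0 : ℂ) (2 * R))
      Metric.isBounded_ball hg.diffContOnCl (fun v hv => hgsphere v ?_) (subset_closure ?_)
    · rw [frontier_ball _ (by positivity)] at hv
      simpa using hv
    · have : ‖w‖ < R := by simpa using hw
      simp
      linarith
  obtain ⟨h, hd, hh0, hexp⟩ := exists_log_of_ne_zero_on_ball hR hg hgne hg0
  have hre : Set.MapsTo h (Metric.ball 0 R) {v | v.re ≤ M} := by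
    intro w hw
    have := hgball w hw
    rw [← hexp w hw, Complex.norm_exp, Real.exp_le_exp] at this
    exact this
  have hsub : Metric.ball (0 : ℂ) (R / 2) ⊆ Metric.ball 0 R :=
    Metric.ball_subset_ball (by linarith)
  have hhB : ∀ w ∈ Metric.ball (0 : ℂ) (R / 2), ‖h w‖ ≤ 2 * M := by
    intro w hw
    have hw' : ‖w‖ < R / 2 := by simpa using hw
    refine (Complex.borelCaratheodory_zero hM hd hre hR (hsub hw) hh0).trans ?_
    rw [div_le_iff₀ (by linarith)]
    nlinarith [norm_nonneg w]
  have hz' : z ∈ Metric.ball (0 : ℂ) (R / 2) := by simpa using hz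
  have hrem := norm_sub_deriv_mul_le (by positivity) (hd.mono hsub) hh0 hhB hz'
  have hderiv : deriv h 0 = deriv f 0 + ∑ a ∈ S, (analyticOrderNatAt f a : ℂ) / a := by
    have hnhds : Metric.ball (0 : ℂ) R ∈ 𝓝 (0 : ℂ) := Metric.ball_mem_nhds _ hR
    have hha : HasDerivAt h (deriv h 0) 0 := (hd.differentiableAt hnhds).hasDerivAt
    have hga : HasDerivAt g (deriv h 0) 0 := by
      have := hha.cexp
      rw [hh0, Complex.exp_zero, one_mul] at this
      refine this.congr_of_eventuallyEq ?_
      filter_upwards [hnhds] with w hw using (hexp w hw).symm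
    have hprod := (hasDerivAt_prod_one_sub_div_pow S (analyticOrderNatAt f)).fun_mul hga
    rw [← funext hfg] at hprod
    rw [hprod.deriv]
    simp [hg0]
  refine ⟨h z - deriv h 0 * z, hrem.trans (le_of_eq ?_), ?_⟩
  · field_simp
    ring
  · have hexps : Complex.exp (deriv h 0 * z) = Complex.exp (deriv f 0 * z) *
        ∏ a ∈ S, Complex.exp (z * a⁻¹) ^ analyticOrderNatAt f a := by
      rw [hderiv, add_mul, Complex.exp_add, Finset.sum_mul, Complex.exp_sum]
      congr 1
      refine Finset.prod_congr rfl fun a _ => ?_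
      rw [← Complex.exp_nat_mul]
      congr 1
      ring
    have hgz : g z = Complex.exp (deriv h 0 * z) * Complex.exp (h z - deriv h 0 * z) := by
      rw [← Complex.exp_add, add_sub_cancel, hexp z (hsub hz')]
    rw [hfg z, hgz, hexps]
    simp only [mul_pow, Finset.prod_mul_distrib, div_eq_mul_inv]
    ring

theorem one_add_sum_le_prod_one_add {ι : Type*} (s : Finset ι) {x : ι → ℝ} (hx : ∀ i, 0 ≤ x i) :
    1 + ∑ i ∈ s, x i ≤ ∏ i ∈ s, (1 + x i) := by
  classical
  induction s using Finset.induction_on with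
  | empty => simp
  | insert i s hi ih =>
    rw [Finset.sum_insert hi, Finset.prod_insert hi]
    nlinarith [hx i, Finset.sum_nonneg fun j (_ : j ∈ s) => hx j, mul_nonneg (hx i)
      (Finset.sum_nonneg fun j (_ : j ∈ s) => hx j)]

/-- **Hadamard's factorization**, for an entire function of order at most two and minimal type
(in particular, of order less than two) all of whose zeros are real. -/
theorem exists_hasProd_of_real_zeros {f : ℂ → ℂ} (hf : Differentiable ℂ f) (h0 : f 0 = 1)
    (hgrowth : ∀ δ : ℝ, 0 < δ → ∃ C : ℝ, ∀ z, ‖f z‖ ≤ C * Real.exp (δ * ‖z‖ ^ 2))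
    (hreal : ∀ z, f z = 0 → z.im = 0) :
    ∃ w : ℕ → ℝ, (Summable fun k => w k ^ 2) ∧
      ∀ z : ℂ, HasProd (fun k => (1 - z * (w k : ℂ)) * Complex.exp (z * (w k : ℂ)))
        (f z * Complex.exp (-(deriv f 0 * z))) := by
  classical
  have hfin := finite_zeros_inter_ball hf (x := 0) (by simp [h0])
  set S : ℕ → Finset ℂ := fun N => (hfin N).toFinset with hSdef
  have hS : ∀ N a, a ∈ S N ↔ f a = 0 ∧ ‖a‖ < N := fun N a => by simp [hSdef]
  -- the zeros, listed with multiplicity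
  let ι := Σ a : ℂ, Fin (analyticOrderNatAt f a)
  have hzero : ∀ i : ι, f i.1 = 0 := by
    rintro ⟨a, j⟩
    exact apply_eq_zero_of_analyticOrderNatAt_ne_zero (Nat.pos_of_ne_zero (by
      intro h; exact absurd j.2 (by simp [h]))).ne'
  let T : ℕ → Finset ι := fun N => (S N).sigma fun _ => Finset.univ
  have hTmem : ∀ N i, i ∈ T N ↔ ‖i.1‖ < N := by
    intro N i
    exact Finset.mem_sigma.trans (by simp [hS, hzero])
  have hTtop : Tendsto T atTop atTop := by
    refine tendsto_atTop_finset_of_monotone (fun N N' hN i hi => ?_) fun i => ?_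
    · rw [hTmem] at hi ⊢
      exact hi.trans_le (by exact_mod_cast hN)
    · obtain ⟨N, hN⟩ := exists_nat_gt ‖i.1‖
      exact ⟨N, (hTmem N i).mpr hN⟩
  let v : ι → ℝ := fun i => (i.1⁻¹).re
  have hv : ∀ i : ι, (v i : ℂ) = i.1⁻¹ := by
    intro i
    apply Complex.ext
    · simp [v]
    · simp [Complex.inv_im, hreal _ (hzero i)]
  have hlim : ∀ z, Tendsto
      (fun N => ∏ i ∈ T N, (1 - z * (v i : ℂ)) * Complex.exp (z * (v i : ℂ))) atTop
      (𝓝 (f z * Complex.exp (-(deriv f 0 * z)))) := by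
    intro z
    set p : ℕ → ℂ := fun N => ∏ i ∈ T N, (1 - z * (v i : ℂ)) * Complex.exp (z * (v i : ℂ)) with hp
    have hpe : ∀ N, p N = ∏ a ∈ S N,
        ((1 - z * a⁻¹) * Complex.exp (z * a⁻¹)) ^ analyticOrderNatAt f a := by
      intro N
      simp only [hp, hv]
      exact (Finset.prod_sigma _ _ _).trans (by simp)
    have hstep : ∀ ε : ℝ, 0 < ε → ∀ᶠ N in atTop, ∃ e : ℂ, ‖e‖ ≤ ε ∧
        f z = Complex.exp (deriv f 0 * z) * p N * Complex.exp e := by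
      intro ε hε
      -- with `M = 8 δ N²`, the bound `16 M ‖z‖² / N²` on the error is then at most `ε`
      set δ : ℝ := ε / (128 * (‖z‖ ^ 2 + 1)) with hδ
      have hδ0 : 0 < δ := by positivity
      obtain ⟨C, hC⟩ := hgrowth δ hδ0
      have hC1 : 1 ≤ C := by simpa [h0] using hC 0
      have hlog : ∀ᶠ N : ℕ in atTop, Real.log C ≤ 4 * δ * (N : ℝ) ^ 2 := by
        have : Tendsto (fun N : ℕ => 4 * δ * (N : ℝ) ^ 2) atTop atTop :=
          Tendsto.const_mul_atTop (by positivity)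
            ((tendsto_pow_atTop two_ne_zero).comp tendsto_natCast_atTop_atTop)
        exact this.eventually_ge_atTop _
      obtain ⟨N₀, hN₀⟩ := exists_nat_gt (2 * ‖z‖)
      filter_upwards [hlog, eventually_ge_atTop N₀, eventually_ge_atTop 1] with N h1 h2 h3
      have hN : (0 : ℝ) < N := by exact_mod_cast h3
      have hNz : ‖z‖ < (N : ℝ) / 2 := by
        have : (N₀ : ℝ) ≤ N := by exact_mod_cast h2
        linarith
      have hbound : ∀ w : ℂ, ‖w‖ = 2 * N → ‖f w‖ ≤ Real.exp (8 * δ * (N : ℝ) ^ 2) := by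
        intro w hw
        refine (hC w).trans ?_
        rw [hw]
        nth_rw 1 [← Real.exp_log (show 0 < C by linarith)]
        rw [← Real.exp_add, Real.exp_le_exp]
        linarith
      obtain ⟨e, he, hfe⟩ := exists_factorization_on_ball hf h0 hN (by positivity) hbound (hS N) hNz
      refine ⟨e, he.trans ?_, by rw [hpe]; exact hfe⟩
      rw [hδ]
      have : 16 * (8 * (ε / (128 * (‖z‖ ^ 2 + 1))) * (N : ℝ) ^ 2) / (N : ℝ) ^ 2 * ‖z‖ ^ 2
          = ε * (‖z‖ ^ 2 / (‖z‖ ^ 2 + 1)) := by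
        field_simp
        ring
      rw [this]
      refine mul_le_of_le_one_right hε.le ?_
      rw [div_le_one (by positivity)]
      linarith
    have hlim' : Tendsto (fun N => p N - f z * Complex.exp (-(deriv f 0 * z))) atTop (𝓝 0) := by
      set A : ℂ := f z * Complex.exp (-(deriv f 0 * z)) with hA
      rw [Metric.tendsto_nhds]
      intro η hη
      -- `p N = A exp (-e)` with `e` small
      have hcont : Tendsto (fun e : ℂ => A * Complex.exp (-e) - A) (𝓝 0) (𝓝 0) := by
        have : Continuous fun e : ℂ => A * Complex.exp (-e) - A := by fun_prop
        simpa using this.tendsto 0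
      obtain ⟨ε, hε, hball⟩ := Metric.eventually_nhds_iff.mp (Metric.tendsto_nhds.mp hcont η hη)
      filter_upwards [hstep (ε / 2) (by positivity)] with N ⟨e, he, hfe⟩
      have hpN : p N = A * Complex.exp (-e) := by
        rw [hA, hfe, Complex.exp_neg, Complex.exp_neg]
        field_simp
      rw [hpN]
      exact hball (by simpa using by linarith)
    simpa using hlim'.add_const (f z * Complex.exp (-(deriv f 0 * z)))
  -- at `z = i` the factors have modulus `√(1 + vᵢ²)`, which bounds `∑ vᵢ²`
  have hsum : Summable fun i => v i ^ 2 := by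
    have h1 := ((hlim Complex.I).norm.pow 2).bddAbove_range
    obtain ⟨B, hB⟩ := h1
    refine summable_of_sum_le (c := B) (fun i => sq_nonneg _) fun u => ?_
    obtain ⟨N, hN⟩ := (hTtop.eventually_ge_atTop u).exists
    calc ∑ i ∈ u, v i ^ 2 ≤ ∑ i ∈ T N, v i ^ 2 :=
          Finset.sum_le_sum_of_subset_of_nonneg hN fun _ _ _ => sq_nonneg _
      _ ≤ ∏ i ∈ T N, (1 + v i ^ 2) := by
          linarith [one_add_sum_le_prod_one_add (T N) fun i => sq_nonneg (v i)]
      _ = ‖∏ i ∈ T N, (1 - Complex.I * (v i : ℂ)) * Complex.exp (Complex.I * (v i : ℂ))‖ ^ 2 := by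
          rw [norm_prod, ← Finset.prod_pow]
          refine Finset.prod_congr rfl fun i _ => ?_
          rw [norm_mul, mul_comm Complex.I, Complex.norm_exp_ofReal_mul_I, mul_one,
            Complex.sq_norm, Complex.normSq_apply]
          simp
          ring
      _ ≤ B := hB ⟨N, rfl⟩
  have hprod : ∀ z, HasProd (fun i => (1 - z * (v i : ℂ)) * Complex.exp (z * (v i : ℂ)))
      (f z * Complex.exp (-(deriv f 0 * z))) := by
    intro z
    have hloc := hasProdLocallyUniformlyOn_canonicalProduct (w := fun i => (v i : ℂ))
      (by simpa using hsum) (‖z‖ + 1)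
    have h1 := hloc.hasProd (x := z) (by simp)
    rwa [tendsto_nhds_unique (h1.comp hTtop) (hlim z)] at h1
  -- every `vᵢ` is nonzero, so summability forces the index type to be countable
  have hcount : Countable ι := by
    have := hsum.countable_support
    have huniv : Function.support (fun i => v i ^ 2) = Set.univ := by
      ext i
      have : (v i : ℂ) ≠ 0 := by
        rw [hv, ne_eq, inv_eq_zero]
        intro h
        have := hzero i
        simp [h, h0] at this
      simpa using this
    rw [huniv] at this
    exact Set.countable_univ_iff.mp this
  obtain ⟨em, hem⟩ := exists_injective_nat ι
  -- unused indices receive `w k = 0`, whose factor is `1`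
  refine ⟨Function.extend em v 0, ?_, fun z => ?_⟩
  · have h1 := (hasSum_extend_zero hem).mpr hsum.hasSum
    refine (summable_congr fun k => ?_).mp h1.summable
    by_cases hk : ∃ i, em i = k
    · obtain ⟨i, rfl⟩ := hk
      simp [hem.extend_apply]
    · simp [Function.extend_apply' _ _ _ hk]
  · have h1 := (hasProd_extend_one hem).mpr (hprod z)
    have hext : Function.extend em (fun i => (1 - z * (v i : ℂ)) * Complex.exp (z * (v i : ℂ))) 1 =
        fun k => (1 - z * ((Function.extend em v 0 k : ℝ) : ℂ)) *
          Complex.exp (z * ((Function.extend em v 0 k : ℝ) : ℂ)) := by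
      funext k
      by_cases hk : ∃ i, em i = k
      · obtain ⟨i, rfl⟩ := hk
        simp [hem.extend_apply]
      · simp [Function.extend_apply' _ _ _ hk]
    rwa [hext] at h1

/-! ### Positive definite functions and their Fourier transforms -/

/-- A positive definite integrable function has a non-negative cosine transform. Testing against
`ρ t = e^{iξt}` on `[-R, R]` and rescaling the outer variable by `R` gives the average over
`s ∈ [-1, 1]` of the integrals of `K u * e^{iξu}` over `[-R - R s, R - R s]`, and these exhaust the
line as `R → ∞`. -/
theorem IsPositiveDefiniteKernel.integral_mul_cos_nonneg {K : ℝ → ℝ}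
    (hK : IsPositiveDefiniteKernel K) (hint : Integrable K) (ξ : ℝ) :
    0 ≤ ∫ u : ℝ, K u * Real.cos (ξ * u) := by
  obtain ⟨hcont, hpd⟩ := hK
  set G : ℝ → ℂ := fun u => (K u : ℂ) * Complex.exp (Complex.I * (ξ * u : ℝ)) with hG
  have hGc : Continuous G := by
    rw [hG]
    fun_prop
  have hnorm : ∀ x : ℝ, ‖Complex.exp (Complex.I * (x : ℂ))‖ = 1 := fun x => by
    rw [mul_comm]; exact Complex.norm_exp_ofReal_mul_I x
  have hGi : Integrable G := by
    refine (integrable_norm_iff hGc.aestronglyMeasurable).mp ?_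
    have : (fun u => ‖G u‖) = fun u => ‖K u‖ := by
      funext u
      rw [hG, norm_mul, hnorm, mul_one, Complex.norm_real]
    rw [this]
    exact hint.norm
  let A : ℝ → ℂ := fun R => ∫ s in (-1 : ℝ)..1, ∫ u in (-R - R * s)..(R - R * s), G u
  have hApos : ∀ R, 0 < R → 0 ≤ (A R).re := by
    intro R hR
    set ρ : ℝ → ℂ := (Set.Ioc (-R) R).indicator fun t => Complex.exp (Complex.I * (ξ * t : ℝ))
      with hρ
    have hρm : Measurable ρ := by
      refine Measurable.indicator ?_ measurableSet_Ioc
      exact Continuous.measurable (by fun_prop)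
    have hρs : HasCompactSupport ρ := by
      refine HasCompactSupport.of_support_subset_isCompact (isCompact_Icc (a := -R) (b := R)) ?_
      exact Set.support_indicator_subset.trans Set.Ioc_subset_Icc_self
    have hρi : Integrable ρ := by
      rw [hρ, integrable_indicator_iff measurableSet_Ioc]
      exact ((Continuous.integrableOn_Icc (by fun_prop)).mono_set Set.Ioc_subset_Icc_self)
    have h := (hpd ρ hρm hρs hρi).1
    have hinner : ∀ s : ℝ, ∫ t : ℝ, (K (t - s) : ℂ) * ρ t * (starRingEnd ℂ) (ρ s) =
        (Set.Ioc (-R) R).indicator (fun s => ∫ u in (-R - s)..(R - s), G u) s := by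
      intro s
      by_cases hs : s ∈ Set.Ioc (-R) R
      · rw [Set.indicator_of_mem hs, ← intervalIntegral.integral_comp_sub_right (fun u => G u) s,
          intervalIntegral.integral_of_le (by linarith), ← integral_indicator measurableSet_Ioc]
        congr 1
        funext t
        by_cases ht : t ∈ Set.Ioc (-R) R
        · rw [Set.indicator_of_mem ht, hρ, Set.indicator_of_mem ht, Set.indicator_of_mem hs, hG,
            mul_assoc, ← Complex.exp_conj, ← Complex.exp_add]
          congr 2
          simp
          ring
        · rw [Set.indicator_of_notMem ht, hρ, Set.indicator_of_notMem ht]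
          simp
      · rw [Set.indicator_of_notMem hs, hρ, Set.indicator_of_notMem hs]
        simp
    rw [funext hinner, integral_indicator measurableSet_Ioc,
      ← intervalIntegral.integral_of_le (by linarith)] at h
    have hscale := intervalIntegral.smul_integral_comp_mul_left
      (a := (-1 : ℝ)) (b := 1) (fun s => ∫ u in (-R - s)..(R - s), G u) R
    rw [mul_neg, mul_one] at hscale
    rw [← hscale, Complex.smul_re, smul_eq_mul] at h
    exact nonneg_of_mul_nonneg_right h hR
  have hlim : Tendsto A atTop (𝓝 (∫ _s in (-1 : ℝ)..1, ∫ u, G u)) := by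
    refine intervalIntegral.tendsto_integral_filter_of_dominated_convergence
      (fun _ => ∫ u, ‖G u‖) ?_ ?_ (by simp) ?_
    · refine Eventually.of_forall fun R => Continuous.aestronglyMeasurable ?_
      have hprim : Continuous fun b => ∫ u in (0 : ℝ)..b, G u :=
        intervalIntegral.continuous_primitive (fun a b => hGc.intervalIntegrable a b) 0
      have : (fun s : ℝ => ∫ u in (-R - R * s)..(R - R * s), G u) = fun s =>
          (∫ u in (0 : ℝ)..(R - R * s), G u) - ∫ u in (0 : ℝ)..(-R - R * s), G u := by
        funext s
        rw [intervalIntegral.integral_interval_sub_left] <;> exact hGc.intervalIntegrable _ _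
      rw [this]
      exact (hprim.comp (by fun_prop)).sub (hprim.comp (by fun_prop))
    · refine Eventually.of_forall fun R => Eventually.of_forall fun s _ => ?_
      refine intervalIntegral.norm_integral_le_integral_norm_uIoc.trans ?_
      exact setIntegral_le_integral hGi.norm (Eventually.of_forall fun _ => norm_nonneg _)
    · have hne : ∀ᵐ s : ℝ, s ≠ 1 := by simp [ae_iff]
      filter_upwards [hne] with s hs1 hs
      rw [Set.uIoc_of_le (by norm_num)] at hs
      have hlt : s < 1 := lt_of_le_of_ne hs.2 hs1
      refine intervalIntegral_tendsto_integral hGi ?_ ?_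
      · have : (fun R : ℝ => -R - R * s) = fun R => (-(1 + s)) * R := by funext R; ring
        rw [this]
        exact tendsto_id.const_mul_atTop_of_neg (by linarith [hs.1])
      · have : (fun R : ℝ => R - R * s) = fun R => (1 - s) * R := by funext R; ring
        rw [this]
        exact tendsto_id.const_mul_atTop (by linarith)
  have hre := (Complex.continuous_re.tendsto _).comp hlim
  have h0 := ge_of_tendsto hre ((eventually_gt_atTop 0).mono fun R hR => hApos R hR)
  have hGre : (∫ u, G u).re = ∫ u : ℝ, K u * Real.cos (ξ * u) := by
    rw [← Complex.reCLM_apply, ← Complex.reCLM.integral_comp_comm hGi]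
    congr 1
    funext u
    rw [Complex.reCLM_apply, hG, Complex.re_ofReal_mul, mul_comm Complex.I,
      Complex.exp_ofReal_mul_I_re]
  rw [intervalIntegral.integral_const, Complex.smul_re, hGre] at h0
  norm_num at h0
  exact h0

/-- The elementary half of Bochner's theorem: the Fourier transform of a non-negative integrable
function is positive definite. -/
theorem isPositiveDefiniteKernel_of_eq_integral {K H : ℝ → ℝ} (hK : Continuous K)
    (hH : Integrable H) (hHnn : ∀ ξ, 0 ≤ H ξ)
    (hKH : ∀ u : ℝ, (K u : ℂ) = ∫ ξ : ℝ, (H ξ : ℂ) * Complex.exp (Complex.I * (u * ξ : ℝ))) :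
    IsPositiveDefiniteKernel K := by
  refine ⟨hK, fun ρ hρm _ hρi => ?_⟩
  have hnorm : ∀ x : ℝ, ‖Complex.exp (Complex.I * (x : ℂ))‖ = 1 := fun x => by
    rw [mul_comm]; exact Complex.norm_exp_ofReal_mul_I x
  have hHc : Integrable fun ξ => (H ξ : ℂ) := hH.ofReal
  set T : ℝ → ℂ := fun ξ => ∫ t : ℝ, ρ t * Complex.exp (Complex.I * (t * ξ : ℝ)) with hT
  have hTc : Continuous T := by
    refine continuous_of_dominated (bound := fun t => ‖ρ t‖) (fun ξ => ?_) (fun ξ => ?_) hρi.norm ?_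
    · exact (hρm.mul (Continuous.measurable (by fun_prop))).aestronglyMeasurable
    · exact Eventually.of_forall fun t => by rw [norm_mul, hnorm, mul_one]
    · exact Eventually.of_forall fun t => by fun_prop
  have hTb : ∀ ξ, ‖T ξ‖ ≤ ∫ t, ‖ρ t‖ := by
    intro ξ
    refine (norm_integral_le_integral_norm _).trans_eq ?_
    simp only [norm_mul, hnorm, mul_one]
  have hHT : Integrable fun ξ => (H ξ : ℂ) * T ξ :=
    hHc.mul_bdd hTc.aestronglyMeasurable (Eventually.of_forall hTb)
  have hinner : ∀ s : ℝ, ∫ t : ℝ, (K (t - s) : ℂ) * ρ t * (starRingEnd ℂ) (ρ s) =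
      ∫ ξ : ℝ, (H ξ : ℂ) * T ξ * (Complex.exp (-(Complex.I * (s * ξ : ℝ))) *
        (starRingEnd ℂ) (ρ s)) := by
    intro s
    have h1 : ∀ t : ℝ, (K (t - s) : ℂ) * ρ t * (starRingEnd ℂ) (ρ s) =
        ∫ ξ : ℝ, ρ t * (H ξ : ℂ) * (Complex.exp (Complex.I * ((t - s) * ξ : ℝ)) *
          (starRingEnd ℂ) (ρ s)) := by
      intro t
      rw [hKH, ← integral_mul_const, ← integral_mul_const]
      congr 1
      funext ξ
      ring
    simp only [h1]
    rw [integral_integral_swap]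
    · congr 1
      funext ξ
      rw [hT]
      simp only
      rw [← integral_const_mul, ← integral_mul_const]
      congr 1
      funext t
      have : Complex.exp (Complex.I * ((t - s) * ξ : ℝ)) =
          Complex.exp (Complex.I * (t * ξ : ℝ)) * Complex.exp (-(Complex.I * (s * ξ : ℝ))) := by
        rw [← Complex.exp_add]
        congr 1
        push_cast
        ring
      rw [this]
      ring
    · refine (hρi.mul_prod hHc).mul_bdd (c := ‖ρ s‖) ?_ ?_
      · exact Continuous.aestronglyMeasurable (by fun_prop)
      · refine Eventually.of_forall fun p => ?_
        rw [norm_mul, hnorm, one_mul, RCLike.norm_conj]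
  have houter : ∫ s : ℝ, ∫ t : ℝ, (K (t - s) : ℂ) * ρ t * (starRingEnd ℂ) (ρ s) =
      ∫ ξ : ℝ, ((H ξ * ‖T ξ‖ ^ 2 : ℝ) : ℂ) := by
    simp only [hinner]
    rw [integral_integral_swap]
    · congr 1
      funext ξ
      rw [integral_const_mul]
      have h2 : ∫ s : ℝ, Complex.exp (-(Complex.I * (s * ξ : ℝ))) * (starRingEnd ℂ) (ρ s) =
          (starRingEnd ℂ) (T ξ) := by
        rw [hT]
        simp only
        rw [← integral_conj]
        congr 1
        funext s
        rw [map_mul, ← Complex.exp_conj, map_mul, Complex.conj_I, Complex.conj_ofReal]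
        ring_nf
      rw [h2, mul_assoc, Complex.mul_conj, Complex.normSq_eq_norm_sq]
      push_cast
      ring
    · have hconj : Integrable fun s => (starRingEnd ℂ) (ρ s) :=
        (Complex.conjLIE.integrable_comp_iff).mpr hρi
      have h3 := (hconj.mul_prod hHT).mul_bdd (c := 1)
        (g := fun p : ℝ × ℝ => Complex.exp (-(Complex.I * (p.1 * p.2 : ℝ)))) ?_ ?_
      · refine h3.congr (Eventually.of_forall fun p => ?_)
        simp only [Function.uncurry]
        ring
      · exact Continuous.aestronglyMeasurable (by fun_prop)
      · refine Eventually.of_forall fun p => ?_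
        have := hnorm (-(p.1 * p.2))
        push_cast at this ⊢
        rw [← mul_neg, this]
  rw [houter, integral_complex_ofReal]
  refine ⟨?_, Complex.ofReal_im _⟩
  rw [Complex.ofReal_re]
  exact integral_nonneg fun ξ => mul_nonneg (hHnn ξ) (sq_nonneg _)

/-! ### Decay of an admissible kernel -/

theorem integrable_of_norm_le_gaussian {E : Type*} [NormedAddCommGroup E] {f : ℝ → E}
    (hf : AEStronglyMeasurable f) {C : ℝ} (h : ∀ t, ‖f t‖ ≤ C * Real.exp (-t ^ 2)) :
    Integrable f := by
  have h1 : Integrable fun t : ℝ => C * Real.exp (-t ^ 2) := by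
    simpa using (integrable_exp_neg_mul_sq one_pos).const_mul C
  exact h1.mono' hf (Eventually.of_forall h)

namespace IsAdmissibleKernel

variable {φ : ℝ → ℝ} (hφ : IsAdmissibleKernel φ)
include hφ

theorem continuous : Continuous φ := hφ.smooth.continuous

theorem iteratedDeriv_neg (n : ℕ) (t : ℝ) :
    iteratedDeriv n φ (-t) = (-1) ^ n * iteratedDeriv n φ t := by
  have h := iteratedDeriv_comp_neg n φ (-t)
  rw [funext hφ.even, neg_neg] at h
  simpa using h

/-- Every derivative decays faster than any Gaussian. -/
theorem norm_iteratedDeriv_le (n : ℕ) (c : ℝ) :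
    ∃ C : ℝ, ∀ t, ‖iteratedDeriv n φ t‖ ≤ C * Real.exp (-c * t ^ 2) := by
  obtain ⟨ε, hε, hdec⟩ := hφ.decay
  obtain ⟨A, hA⟩ := (hdec n).bound
  have hpow : ∀ᶠ t : ℝ in atTop, c ≤ t ^ ε := (tendsto_rpow_atTop hε).eventually_ge_atTop c
  obtain ⟨T, hT⟩ := (hA.and (hpow.and (eventually_gt_atTop 0))).exists_forall_of_atTop
  have hcont : Continuous fun t => ‖iteratedDeriv n φ t‖ * Real.exp (c * t ^ 2) :=
    (hφ.smooth.continuous_iteratedDeriv n (by exact_mod_cast le_top)).norm.mul (by fun_prop)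
  obtain ⟨B, hB⟩ := (isCompact_Icc (a := 0) (b := T)).bddAbove_image hcont.continuousOn
  have hnn : ∀ t, 0 ≤ t → ‖iteratedDeriv n φ t‖ ≤ max A B * Real.exp (-c * t ^ 2) := by
    intro t ht
    rcases le_total t T with htT | htT
    · have h1 : ‖iteratedDeriv n φ t‖ * Real.exp (c * t ^ 2) ≤ B :=
        hB (Set.mem_image_of_mem _ ⟨ht, htT⟩)
      calc ‖iteratedDeriv n φ t‖
          = ‖iteratedDeriv n φ t‖ * Real.exp (c * t ^ 2) * Real.exp (-c * t ^ 2) := by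
            rw [mul_assoc, ← Real.exp_add]; simp
        _ ≤ max A B * Real.exp (-c * t ^ 2) := by
            gcongr; exact h1.trans (le_max_right _ _)
    · obtain ⟨h1, h2, h3⟩ := hT t htT
      have h4 : Real.exp (-|t| ^ (2 + ε)) ≤ Real.exp (-c * t ^ 2) := by
        rw [Real.exp_le_exp, abs_of_pos h3, Real.rpow_add h3, Real.rpow_two]
        nlinarith [sq_nonneg t]
      rw [Real.norm_of_nonneg (Real.exp_pos _).le] at h1
      have hA0 : 0 ≤ A := nonneg_of_mul_nonneg_left ((norm_nonneg _).trans h1) (Real.exp_pos _)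
      calc _ ≤ A * Real.exp (-|t| ^ (2 + ε)) := h1
        _ ≤ max A B * Real.exp (-c * t ^ 2) :=
          mul_le_mul (le_max_left _ _) h4 (Real.exp_pos _).le (hA0.trans (le_max_left _ _))
  refine ⟨max A B, fun t => ?_⟩
  rcases le_total 0 t with ht | ht
  · exact hnn t ht
  · have := hnn (-t) (by linarith)
    rw [hφ.iteratedDeriv_neg, norm_mul, norm_pow, norm_neg, norm_one, one_pow, one_mul,
      neg_sq] at this
    exact this

theorem le_gaussian (c : ℝ) : ∃ C : ℝ, 0 < C ∧ ∀ t, φ t ≤ C * Real.exp (-c * t ^ 2) := by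
  obtain ⟨C, hC⟩ := hφ.norm_iteratedDeriv_le 0 c
  have h : ∀ t, φ t ≤ C * Real.exp (-c * t ^ 2) := fun t => by
    simpa [abs_of_pos (hφ.pos t)] using hC t
  refine ⟨C, ?_, h⟩
  simpa using (hφ.pos 0).trans_le (h 0)

/-- The functions `(it)ʲ φ(t)` are Schwartz functions. -/
theorem exists_schwartzMap (j : ℕ) :
    ∃ g : SchwartzMap ℝ ℂ, ∀ t : ℝ, g t = (φ t : ℂ) * (Complex.I * t) ^ j := by
  have hdecay : ∀ k n : ℕ, ∃ C, ∀ t : ℝ, ‖t‖ ^ k * ‖iteratedFDeriv ℝ n φ t‖ ≤ C := by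
    intro k n
    obtain ⟨C, hC⟩ := hφ.norm_iteratedDeriv_le n 1
    refine ⟨k.factorial * Real.exp 1 * C, fun t => ?_⟩
    rw [norm_iteratedFDeriv_eq_norm_iteratedDeriv]
    have h1 : ‖t‖ ^ k ≤ k.factorial * Real.exp ‖t‖ := by
      have := Real.pow_div_factorial_le_exp _ (norm_nonneg t) k
      rwa [div_le_iff₀' (by positivity)] at this
    have hC0 : 0 ≤ C := nonneg_of_mul_nonneg_left ((norm_nonneg _).trans (hC 0)) (Real.exp_pos _)
    calc ‖t‖ ^ k * ‖iteratedDeriv n φ t‖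
        ≤ (k.factorial * Real.exp ‖t‖) * (C * Real.exp (-1 * t ^ 2)) :=
          mul_le_mul h1 (hC t) (norm_nonneg _) (by positivity)
      _ = k.factorial * C * Real.exp (‖t‖ + -1 * t ^ 2) := by rw [Real.exp_add]; ring
      _ ≤ k.factorial * C * Real.exp 1 := by
          gcongr
          rw [← sq_abs t, ← Real.norm_eq_abs]
          nlinarith [sq_nonneg (‖t‖ - 1), sq_nonneg ‖t‖]
      _ = _ := by ring
  let Φ : SchwartzMap ℝ ℝ := ⟨φ, hφ.smooth, hdecay⟩
  have hg : Function.HasTemperateGrowth fun t : ℝ => (Complex.I * (t : ℂ)) ^ j := by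
    fun_prop
  refine ⟨SchwartzMap.bilinLeftCLM (ContinuousLinearMap.lsmul ℝ ℝ : ℝ →L[ℝ] ℂ →L[ℝ] ℂ) hg Φ,
    fun t => ?_⟩
  rw [SchwartzMap.bilinLeftCLM_apply]
  exact Complex.real_smul

/-! ### The transform -/

theorem integrable_exp_mul (z : ℂ) :
    Integrable fun t : ℝ => Complex.exp (Complex.I * (t : ℂ) * z) * (φ t : ℂ) := by
  obtain ⟨C, hC0, hC⟩ := hφ.le_gaussian 2
  refine integrable_of_norm_le_gaussian (C := C * Real.exp (z.im ^ 2 / 4)) ?_ fun t => ?_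
  · have := hφ.continuous
    exact Continuous.aestronglyMeasurable (by fun_prop)
  · rw [norm_mul, Complex.norm_exp, Complex.norm_real, Real.norm_of_nonneg (hφ.pos t).le]
    calc Real.exp (Complex.I * (t : ℂ) * z).re * φ t
        ≤ Real.exp (Complex.I * (t : ℂ) * z).re * (C * Real.exp (-2 * t ^ 2)) := by
          gcongr; exact hC t
      _ = C * Real.exp (-(t * z.im) + -2 * t ^ 2) := by
          rw [Real.exp_add]; simp; ring
      _ ≤ C * Real.exp (z.im ^ 2 / 4 + -t ^ 2) := by
          gcongr ?_ * Real.exp ?_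
          nlinarith [sq_nonneg (t + z.im / 2)]
      _ = _ := by rw [Real.exp_add]; ring

theorem norm_kernelTransform_le {δ : ℝ} (hδ : 0 < δ) :
    ∃ C : ℝ, ∀ z, ‖kernelTransform φ z‖ ≤ C * Real.exp (δ * ‖z‖ ^ 2) := by
  obtain ⟨C, hC0, hC⟩ := hφ.le_gaussian (1 + 1 / (4 * δ))
  refine ⟨C * ∫ t : ℝ, Real.exp (-t ^ 2), fun z => ?_⟩
  have hgauss : Integrable fun t : ℝ => Real.exp (-t ^ 2) := by
    simpa using integrable_exp_neg_mul_sq one_pos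
  have hb : ∀ t : ℝ, ‖Complex.exp (Complex.I * (t : ℂ) * z) * (φ t : ℂ)‖ ≤
      C * Real.exp (δ * ‖z‖ ^ 2) * Real.exp (-t ^ 2) := by
    intro t
    rw [norm_mul, Complex.norm_exp, Complex.norm_real, Real.norm_of_nonneg (hφ.pos t).le]
    have h1 : (Complex.I * (t : ℂ) * z).re ≤ δ * ‖z‖ ^ 2 + t ^ 2 / (4 * δ) := by
      have h2 : (Complex.I * (t : ℂ) * z).re = -(t * z.im) := by simp
      have h3 : z.im ^ 2 ≤ ‖z‖ ^ 2 := by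
        rw [← sq_abs z.im]; gcongr; exact Complex.abs_im_le_norm z
      have h4 : δ * z.im ^ 2 + t ^ 2 / (4 * δ) + t * z.im = (2 * δ * z.im + t) ^ 2 / (4 * δ) := by
        field_simp
        ring
      have h5 : 0 ≤ (2 * δ * z.im + t) ^ 2 / (4 * δ) := by positivity
      rw [h2]
      nlinarith
    calc Real.exp (Complex.I * (t : ℂ) * z).re * φ t
        ≤ Real.exp (δ * ‖z‖ ^ 2 + t ^ 2 / (4 * δ)) *
            (C * Real.exp (-(1 + 1 / (4 * δ)) * t ^ 2)) :=
          mul_le_mul (Real.exp_le_exp.mpr h1) (hC t) (hφ.pos t).le (Real.exp_pos _).le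
      _ = C * Real.exp (δ * ‖z‖ ^ 2) * Real.exp (-t ^ 2) := by
          rw [mul_left_comm, ← Real.exp_add, mul_assoc, ← Real.exp_add]
          congr 2
          ring
  calc ‖kernelTransform φ z‖
      ≤ ∫ t : ℝ, ‖Complex.exp (Complex.I * (t : ℂ) * z) * (φ t : ℂ)‖ :=
        norm_integral_le_integral_norm _
    _ ≤ ∫ t : ℝ, C * Real.exp (δ * ‖z‖ ^ 2) * Real.exp (-t ^ 2) :=
        integral_mono (hφ.integrable_exp_mul z).norm (hgauss.const_mul _) hb
    _ = _ := by rw [integral_const_mul]; ring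

theorem kernelTransform_neg (z : ℂ) : kernelTransform φ (-z) = kernelTransform φ z := by
  unfold kernelTransform
  rw [← integral_neg_eq_self]
  congr 1
  funext t
  rw [hφ.even]
  push_cast
  congr 2
  ring

theorem kernelTransform_zero_re_pos : 0 < (kernelTransform φ 0).re := by
  have h1 : kernelTransform φ 0 = ((∫ t, φ t : ℝ) : ℂ) := by
    unfold kernelTransform
    rw [← integral_complex_ofReal]
    simp
  have hint : Integrable φ := by
    simpa using (hφ.integrable_exp_mul 0).re
  rw [h1, Complex.ofReal_re, integral_pos_iff_support_of_nonneg (fun t => (hφ.pos t).le) hint]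
  have : Function.support φ = Set.univ := by
    ext t
    simpa using (hφ.pos t).ne'
  rw [this]
  simp

theorem kernelTransform_ofReal_im (x : ℝ) : (kernelTransform φ x).im = 0 := by
  rw [← Complex.conj_eq_iff_im, ← hφ.kernelTransform_neg x]
  unfold kernelTransform
  rw [← integral_conj, ← integral_neg_eq_self]
  congr 1
  funext t
  rw [map_mul, ← Complex.exp_conj, Complex.conj_ofReal, hφ.even]
  simp

/-- The transform is a moment generating function, evaluated on the imaginary axis. -/
theorem kernelTransform_eq_complexMGF : kernelTransform φ = fun z => ProbabilityTheory.complexMGF id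
    (volume.withDensity fun t => ENNReal.ofReal (φ t)) (Complex.I * z) := by
  funext z
  rw [kernelTransform, ProbabilityTheory.complexMGF,
    integral_withDensity_eq_integral_toReal_smul hφ.continuous.measurable.ennreal_ofReal (by simp)]
  congr 1
  funext t
  rw [ENNReal.toReal_ofReal (hφ.pos t).le, Complex.real_smul, mul_comm]
  congr 2
  simp
  ring

theorem integrableExpSet_eq_univ : ProbabilityTheory.integrableExpSet id
    (volume.withDensity fun t => ENNReal.ofReal (φ t)) = Set.univ := by
  refine Set.eq_univ_of_forall fun r => ?_
  change Integrable _ _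
  rw [integrable_withDensity_iff hφ.continuous.measurable.ennreal_ofReal (by simp)]
  refine (hφ.integrable_exp_mul (-Complex.I * r)).norm.congr (Eventually.of_forall fun t => ?_)
  simp only [norm_mul, Complex.norm_exp, Complex.norm_real, Real.norm_of_nonneg (hφ.pos t).le,
    ENNReal.toReal_ofReal (hφ.pos t).le, id]
  congr 2
  simp
  ring

theorem differentiable_complexMGF : Differentiable ℂ (ProbabilityTheory.complexMGF id
    (volume.withDensity fun t => ENNReal.ofReal (φ t))) := by
  rw [← differentiableOn_univ]
  have := ProbabilityTheory.differentiableOn_complexMGF (X := id)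
    (μ := volume.withDensity fun t => ENNReal.ofReal (φ t))
  rw [hφ.integrableExpSet_eq_univ] at this
  simpa using this

theorem differentiable_kernelTransform : Differentiable ℂ (kernelTransform φ) := by
  rw [hφ.kernelTransform_eq_complexMGF]
  exact hφ.differentiable_complexMGF.comp (by fun_prop)

theorem isRealEntire_kernelTransform : IsRealEntire (kernelTransform φ) :=
  ⟨hφ.differentiable_kernelTransform, hφ.kernelTransform_ofReal_im⟩

theorem iteratedDeriv_kernelTransform (j : ℕ) (z : ℂ) :
    iteratedDeriv j (kernelTransform φ) z =
      ∫ t : ℝ, (φ t : ℂ) * (Complex.I * t) ^ j * Complex.exp (Complex.I * t * z) := by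
  rw [hφ.kernelTransform_eq_complexMGF,
    iteratedDeriv_comp_const_mul hφ.differentiable_complexMGF.contDiff]
  simp only
  rw [ProbabilityTheory.iteratedDeriv_complexMGF (by rw [hφ.integrableExpSet_eq_univ]; simp),
    integral_withDensity_eq_integral_toReal_smul hφ.continuous.measurable.ennreal_ofReal (by simp),
    ← integral_const_mul]
  congr 1
  funext t
  rw [ENNReal.toReal_ofReal (hφ.pos t).le, Complex.real_smul]
  simp only [id]
  rw [show Complex.I * z * t = Complex.I * t * z by ring]
  ring

/-- On the real line the derivatives of the transform are (rescaled) Fourier transforms of Schwartz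
functions. -/
theorem exists_schwartzMap_iteratedDeriv (j : ℕ) : ∃ g : SchwartzMap ℝ ℂ, ∀ ξ : ℝ,
    iteratedDeriv j (kernelTransform φ) ((Real.pi * ξ : ℝ) : ℂ) = g (-(ξ / 2)) := by
  obtain ⟨g, hg⟩ := hφ.exists_schwartzMap j
  refine ⟨FourierTransform.fourier g, fun ξ => ?_⟩
  rw [hφ.iteratedDeriv_kernelTransform, SchwartzMap.fourier_coe,
    Real.fourier_real_eq_integral_exp_smul]
  congr 1
  funext t
  rw [hg, smul_eq_mul, mul_comm]
  congr 2
  push_cast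
  ring

theorem integrable_laguerreExpression (n : ℕ) :
    Integrable fun ξ : ℝ => laguerreExpression n (kernelTransform φ) (Real.pi * ξ) := by
  unfold laguerreExpression
  refine integrable_finsetSum _ fun j _ => ?_
  obtain ⟨g, hg⟩ := hφ.exists_schwartzMap_iteratedDeriv j
  obtain ⟨h, hh⟩ := hφ.exists_schwartzMap_iteratedDeriv (2 * n - j)
  simp only [hg, hh]
  have hcomp : ∀ f : SchwartzMap ℝ ℂ, Continuous fun ξ : ℝ => f (-(ξ / 2)) := fun f =>
    f.continuous.comp (by fun_prop)
  have h1 : Integrable fun ξ : ℝ => g (-(ξ / 2)) := by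
    have := (g.integrable (μ := volume)).comp_mul_left' (R := -(1 / 2)) (by norm_num)
    refine this.congr (Eventually.of_forall fun ξ => ?_)
    simp only
    congr 1
    ring
  obtain ⟨C, hC⟩ := h.decay 0 0
  refine (h1.const_mul _).mul_bdd (c := C) (hcomp h).aestronglyMeasurable
    (Eventually.of_forall fun ξ => ?_)
  simpa using hC.2 (-(ξ / 2))

/-! ### The associated kernels -/

/-- Since `(s + t)² + (s - t)² = 2 s² + 2 t²`, Gaussian decay of `φ` separates the variables. -/
theorem associated_integrand_le (n : ℕ) : ∃ C : ℝ, 0 < C ∧ ∀ s t : ℝ,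
    ‖φ (s + t) * φ (s - t) * s ^ (2 * n)‖ ≤ C * (Real.exp (-s ^ 2) * Real.exp (-t ^ 2)) := by
  obtain ⟨C, hC0, hC⟩ := hφ.le_gaussian 1
  refine ⟨C ^ 2 * n.factorial, by positivity, fun s t => ?_⟩
  have h1 : s ^ (2 * n) ≤ n.factorial * Real.exp (s ^ 2) := by
    have := Real.pow_div_factorial_le_exp _ (sq_nonneg s) n
    rwa [div_le_iff₀' (by positivity), ← pow_mul] at this
  have hs : 0 ≤ s ^ (2 * n) := by rw [pow_mul]; positivity
  rw [Real.norm_of_nonneg (mul_nonneg (mul_pos (hφ.pos _) (hφ.pos _)).le hs)]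
  calc φ (s + t) * φ (s - t) * s ^ (2 * n)
      ≤ (C * Real.exp (-1 * (s + t) ^ 2)) * (C * Real.exp (-1 * (s - t) ^ 2)) *
          (n.factorial * Real.exp (s ^ 2)) :=
        mul_le_mul (mul_le_mul (hC _) (hC _) (hφ.pos _).le (by positivity)) h1 hs (by positivity)
    _ = C ^ 2 * n.factorial * (Real.exp (-1 * (s + t) ^ 2) * Real.exp (-1 * (s - t) ^ 2) *
          Real.exp (s ^ 2)) := by ring
    _ = C ^ 2 * n.factorial * Real.exp (-s ^ 2 + -(2 * t ^ 2)) := by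
        rw [← Real.exp_add, ← Real.exp_add]
        congr 2
        ring
    _ ≤ C ^ 2 * n.factorial * Real.exp (-s ^ 2 + -t ^ 2) := by
        gcongr ?_ * Real.exp ?_
        nlinarith [sq_nonneg t]
    _ = _ := by rw [Real.exp_add]

theorem integrable_associated_integrand (n : ℕ) (t : ℝ) :
    Integrable fun s : ℝ => φ (s + t) * φ (s - t) * s ^ (2 * n) := by
  obtain ⟨C, -, hC⟩ := hφ.associated_integrand_le n
  have := hφ.continuous
  refine integrable_of_norm_le_gaussian (C := C * Real.exp (-t ^ 2))
    (Continuous.aestronglyMeasurable (by fun_prop)) fun s => (hC s t).trans_eq (by ring)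

theorem continuous_associatedKernel (n : ℕ) : Continuous (associatedKernel φ n) := by
  obtain ⟨C, hC0, hC⟩ := hφ.associated_integrand_le n
  have hc := hφ.continuous
  refine continuous_of_dominated (bound := fun s => C * Real.exp (-s ^ 2)) (fun t => ?_)
    (fun t => Eventually.of_forall fun s => (hC s t).trans ?_) ?_
    (Eventually.of_forall fun s => by fun_prop)
  · exact (hφ.integrable_associated_integrand n t).aestronglyMeasurable
  · have : Real.exp (-t ^ 2) ≤ 1 := Real.exp_le_one_iff.mpr (by nlinarith [sq_nonneg t])
    have h2 := mul_le_of_le_one_right (Real.exp_pos (-s ^ 2)).le this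
    exact mul_le_mul_of_nonneg_left h2 hC0.le
  · simpa using (integrable_exp_neg_mul_sq one_pos).const_mul C

theorem integrable_associatedKernel (n : ℕ) : Integrable (associatedKernel φ n) := by
  obtain ⟨C, hC0, hC⟩ := hφ.associated_integrand_le n
  have hgauss : Integrable fun t : ℝ => Real.exp (-t ^ 2) := by
    simpa using integrable_exp_neg_mul_sq one_pos
  refine integrable_of_norm_le_gaussian (C := C * ∫ s : ℝ, Real.exp (-s ^ 2))
    (hφ.continuous_associatedKernel n).aestronglyMeasurable fun t => ?_
  calc ‖associatedKernel φ n t‖ ≤ ∫ s : ℝ, ‖φ (s + t) * φ (s - t) * s ^ (2 * n)‖ :=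
        norm_integral_le_integral_norm _
    _ ≤ ∫ s : ℝ, C * (Real.exp (-s ^ 2) * Real.exp (-t ^ 2)) :=
        integral_mono (hφ.integrable_associated_integrand n t).norm
          ((hgauss.mul_const _).const_mul _) fun s => hC s t
    _ = _ := by rw [integral_const_mul, integral_mul_const]; ring

end IsAdmissibleKernel

/-! ### The Laguerre expressions of the transform -/

/-- The change of variables `(u, v) = (t - s, t + s)`, of Jacobian `2`. -/
theorem integral_prod_eq_two_mul_integral_sub_add {Φ : ℝ × ℝ → ℂ} (hΦ : Integrable Φ) :
    ∫ p, Φ p = 2 * ∫ t : ℝ, ∫ s : ℝ, Φ (t - s, t + s) := by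
  have hmp : MeasurePreserving (fun p : ℝ × ℝ => (p.2, p.1 - p.2)) volume volume :=
    measurePreserving_prod_sub_swap volume volume
  have h1 : ∫ p, Φ p = ∫ p : ℝ × ℝ, Φ (p.2, p.1 - p.2) := by
    conv_lhs => rw [← hmp.map_eq]
    rw [integral_map hmp.measurable.aemeasurable (by rw [hmp.map_eq]; exact hΦ.1)]
  have hint : Integrable fun p : ℝ × ℝ => Φ (p.2, p.1 - p.2) := hmp.integrable_comp_of_integrable hΦ
  have h2 := Measure.integral_comp_mul_left (fun w : ℝ => ∫ u : ℝ, Φ (u, w - u)) 2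
  have h3 : ∀ t : ℝ, ∫ u : ℝ, Φ (u, 2 * t - u) = ∫ s : ℝ, Φ (t - s, t + s) := by
    intro t
    rw [← integral_sub_left_eq_self _ volume t]
    congr 1
    funext s
    congr 2
    ring
  rw [h1, Measure.volume_eq_prod, integral_prod _ hint, ← funext h3, h2]
  rw [abs_of_pos (by norm_num), Complex.real_smul]
  push_cast
  ring

theorem associatedKernel_neg (φ : ℝ → ℝ) (n : ℕ) (t : ℝ) :
    associatedKernel φ n (-t) = associatedKernel φ n t := by
  unfold associatedKernel
  congr 1
  funext s
  rw [sub_neg_eq_add, ← sub_eq_add_neg]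
  ring

theorem integral_mul_exp_eq_integral_mul_cos {K : ℝ → ℝ} (hK : Integrable K)
    (heven : ∀ t, K (-t) = K t) (a : ℝ) :
    ∫ t : ℝ, (K t : ℂ) * Complex.exp (Complex.I * (a * t : ℝ)) =
      ((∫ t : ℝ, K t * Real.cos (a * t) : ℝ) : ℂ) := by
  have hcos : Integrable fun t => K t * Real.cos (a * t) :=
    hK.mul_bdd (c := 1) (Continuous.aestronglyMeasurable (by fun_prop))
      (Eventually.of_forall fun t => Real.abs_cos_le_one _)
  have hsin : Integrable fun t => K t * Real.sin (a * t) :=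
    hK.mul_bdd (c := 1) (Continuous.aestronglyMeasurable (by fun_prop))
      (Eventually.of_forall fun t => Real.abs_sin_le_one _)
  have hodd : ∫ t : ℝ, K t * Real.sin (a * t) = 0 := by
    have h := integral_neg_eq_self (fun t : ℝ => K t * Real.sin (a * t)) volume
    simp only [heven, mul_neg, Real.sin_neg, integral_neg] at h
    linarith
  have hsplit : ∀ t : ℝ, (K t : ℂ) * Complex.exp (Complex.I * (a * t : ℝ)) =
      ((K t * Real.cos (a * t) : ℝ) : ℂ) + Complex.I * ((K t * Real.sin (a * t) : ℝ) : ℂ) := by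
    intro t
    rw [mul_comm Complex.I, Complex.exp_mul_I, ← Complex.ofReal_cos, ← Complex.ofReal_sin]
    push_cast
    ring
  simp only [hsplit]
  rw [integral_add hcos.ofReal (hsin.ofReal.const_mul _), integral_const_mul,
    integral_complex_ofReal, integral_complex_ofReal, hodd]
  simp

/-- The integrand of the double integral for the Laguerre expression: the alternating binomial sum
collapses to `(v - u) ^ (2 n) / (2 n)!`. -/
theorem sum_alternating_choose_mul_pow (n : ℕ) (u v : ℂ) :
    ∑ j ∈ Finset.range (2 * n + 1), (-1 : ℂ) ^ (j + n) / (Nat.factorial (2 * n) : ℂ) *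
      (Nat.choose (2 * n) j : ℂ) * ((Complex.I * u) ^ j * (Complex.I * v) ^ (2 * n - j)) =
      (v - u) ^ (2 * n) / (Nat.factorial (2 * n) : ℂ) := by
  have h1 : (v - u) ^ (2 * n) = (-1) ^ n * (-(Complex.I * u) + Complex.I * v) ^ (2 * n) := by
    rw [show -(Complex.I * u) + Complex.I * v = Complex.I * (v - u) by ring, mul_pow,
      pow_mul Complex.I, Complex.I_sq, ← mul_assoc, ← mul_pow]
    simp
  rw [h1, add_pow, Finset.mul_sum, Finset.sum_div]
  refine Finset.sum_congr rfl fun j _ => ?_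
  rw [neg_pow (Complex.I * u) j, pow_add]
  ring

theorem IsAdmissibleKernel.laguerreExpression_kernelTransform {φ : ℝ → ℝ}
    (hφ : IsAdmissibleKernel φ) (n : ℕ) (x : ℝ) :
    laguerreExpression n (kernelTransform φ) x =
      ((2 * 2 ^ (2 * n) / (Nat.factorial (2 * n) : ℝ) *
        ∫ t : ℝ, associatedKernel φ n t * Real.cos (2 * x * t) : ℝ) : ℂ) := by
  set g : ℕ → ℝ → ℂ := fun j t =>
    (φ t : ℂ) * (Complex.I * t) ^ j * Complex.exp (Complex.I * t * x) with hg
  have hgint : ∀ j, Integrable (g j) := by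
    intro j
    obtain ⟨h, hh⟩ := hφ.exists_schwartzMap j
    have h1 := (h.integrable (μ := volume)).mul_bdd (c := 1)
      (g := fun t : ℝ => Complex.exp (Complex.I * t * x))
      (Continuous.aestronglyMeasurable (by fun_prop))
      (Eventually.of_forall fun t => by rw [Complex.norm_exp]; simp)
    simpa only [hh] using h1
  set c : ℕ → ℂ := fun j => (-1 : ℂ) ^ (j + n) / (Nat.factorial (2 * n) : ℂ) *
    (Nat.choose (2 * n) j : ℂ) with hc
  set Φ : ℝ × ℝ → ℂ := fun p => ((p.2 : ℂ) - p.1) ^ (2 * n) / (Nat.factorial (2 * n) : ℂ) *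
    ((φ p.1 : ℂ) * φ p.2 * Complex.exp (Complex.I * (p.1 + p.2) * x)) with hΦ
  have hterm : ∀ j, Integrable fun p : ℝ × ℝ => c j * (g j p.1 * g (2 * n - j) p.2) := fun j =>
    ((hgint j).mul_prod (hgint (2 * n - j))).const_mul _
  have hsum : ∀ p : ℝ × ℝ,
      ∑ j ∈ Finset.range (2 * n + 1), c j * (g j p.1 * g (2 * n - j) p.2) = Φ p := by
    intro p
    rw [hΦ]
    simp only
    rw [← sum_alternating_choose_mul_pow, Finset.sum_mul]
    refine Finset.sum_congr rfl fun j _ => ?_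
    rw [show Complex.I * ((p.1 : ℂ) + p.2) * x = Complex.I * p.1 * x + Complex.I * p.2 * x by ring,
      Complex.exp_add]
    simp only [hc, hg]
    ring
  have hΦint : Integrable Φ := by
    rw [← funext hsum]
    exact integrable_finsetSum _ fun j _ => hterm j
  have h1 : laguerreExpression n (kernelTransform φ) x = ∫ p, Φ p := by
    rw [← funext hsum, integral_finsetSum _ fun j _ => hterm j, laguerreExpression]
    refine Finset.sum_congr rfl fun j _ => ?_
    rw [integral_const_mul, Measure.volume_eq_prod, integral_prod_mul,
      hφ.iteratedDeriv_kernelTransform, hφ.iteratedDeriv_kernelTransform, mul_assoc]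
  have h2 : ∀ t : ℝ, ∫ s : ℝ, Φ (t - s, t + s) = (2 ^ (2 * n) / (Nat.factorial (2 * n) : ℂ)) *
      ((associatedKernel φ n t : ℂ) * Complex.exp (Complex.I * (2 * x * t : ℝ))) := by
    intro t
    rw [associatedKernel, ← integral_complex_ofReal, ← integral_mul_const, ← integral_const_mul]
    congr 1
    funext s
    rw [hΦ]
    simp only
    have he : φ (t - s) = φ (s - t) := by rw [← hφ.even]; congr 1; ring
    rw [he, add_comm t s]
    have hx : Complex.I * (((t - s : ℝ) : ℂ) + ((s + t : ℝ) : ℂ)) * x =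
        Complex.I * ((2 * x * t : ℝ) : ℂ) := by
      push_cast
      ring
    have hp : (((s + t : ℝ) : ℂ) - ((t - s : ℝ) : ℂ)) = 2 * s := by
      push_cast
      ring
    rw [hx, hp, mul_pow]
    push_cast
    ring
  rw [h1, integral_prod_eq_two_mul_integral_sub_add hΦint, funext h2, integral_const_mul,
    integral_mul_exp_eq_integral_mul_cos (hφ.integrable_associatedKernel n)
      (associatedKernel_neg φ n)]
  push_cast
  ring

/-! ### Real zeros and the Laguerre–Pólya class -/

/-- An entire function that has non-negative Laguerre expressions and does not vanish identically has
only real zeros: at a zero `x + iy` with `y ≠ 0` the series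
`∑ Lₙ(x) y ^ (2 n) = f (x + iy) f (x - iy)` of non-negative terms vanishes, hence so do all `Lₙ(x)`,
and `f (x + iy) f (x - iy)` is zero for every `y`. -/
theorem HasNonnegLaguerre.im_eq_zero {f : ℂ → ℂ} (hf : HasNonnegLaguerre f)
    (hne : f ≠ 0) {z : ℂ} (hz : f z = 0) : z.im = 0 := by
  by_contra hy
  have h1 := hasSum_laguerreExpression hf.1 z.re z.im
  have hzz : (z.re : ℂ) + Complex.I * z.im = z := by rw [mul_comm]; exact Complex.re_add_im z
  rw [hzz, hz, zero_mul] at h1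
  have hy0 : ∀ n : ℕ, (0 : ℝ) < z.im ^ (2 * n) := fun n => by
    rw [pow_mul]; positivity
  have h2 : ∀ n, laguerreExpression n f z.re = 0 := by
    have hnn : ∀ n, 0 ≤ laguerreExpression n f z.re * (z.im : ℂ) ^ (2 * n) := fun n =>
      mul_nonneg (hf.2 n _) (by exact_mod_cast (hy0 n).le)
    intro n
    have h3 := congrFun ((hasSum_zero_iff_of_nonneg hnn).mp h1) n
    have : (z.im : ℂ) ^ (2 * n) ≠ 0 := by exact_mod_cast (hy0 n).ne'
    exact (mul_eq_zero.mp h3).resolve_right this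
  have hmul : ∀ y : ℂ, f (z.re + Complex.I * y) * f (z.re - Complex.I * y) = 0 := by
    intro y
    have h3 := hasSum_laguerreExpression hf.1 z.re y
    simp only [h2, zero_mul] at h3
    exact h3.unique hasSum_zero
  -- the product of two entire functions vanishes identically, so one of the factors does
  have hA : AnalyticOnNhd ℂ (fun y => f (z.re + Complex.I * y)) Set.univ := fun y _ =>
    Differentiable.analyticAt (hf.1.comp (by fun_prop)) y
  have hB : AnalyticOnNhd ℂ (fun y => f (z.re - Complex.I * y)) Set.univ := fun y _ =>
    Differentiable.analyticAt (hf.1.comp (by fun_prop)) y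
  apply hne
  funext w
  rcases hA.eq_zero_or_eq_zero_of_mul_eq_zero hB (fun y _ => hmul y) isPreconnected_univ with h | h
  · have := h (-Complex.I * (w - z.re)) (Set.mem_univ _)
    simpa [← mul_assoc] using this
  · have := h (Complex.I * (w - z.re)) (Set.mem_univ _)
    simpa [← mul_assoc] using this

theorem IsAdmissibleKernel.isLaguerrePolya_of_hasNonnegLaguerre {φ : ℝ → ℝ}
    (hφ : IsAdmissibleKernel φ) (h : HasNonnegLaguerre (kernelTransform φ)) :
    IsLaguerrePolya (kernelTransform φ) := by
  set F := kernelTransform φ with hF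
  have hF0 : F 0 ≠ 0 := fun h0 => by
    have := hφ.kernelTransform_zero_re_pos
    rw [← hF, h0] at this
    simp at this
  have hF0' : ((F 0).re : ℂ) = F 0 := by
    apply Complex.ext
    · simp
    · simpa using (hφ.kernelTransform_ofReal_im 0).symm
  have hd : Differentiable ℂ fun z => F z / F 0 := h.1.div_const _
  -- `F` is even, so no factor `exp (b z)` occurs
  have hderiv : deriv (fun z => F z / F 0) 0 = 0 := by
    have h1 := deriv_comp_neg F 0
    rw [funext hφ.kernelTransform_neg, neg_zero] at h1
    rw [deriv_div_const, self_eq_neg.mp h1, zero_div]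
  obtain ⟨w, hw, hprod⟩ := exists_hasProd_of_real_zeros hd (div_self hF0) (fun δ hδ => by
      obtain ⟨C, hC⟩ := hφ.norm_kernelTransform_le hδ
      refine ⟨C / ‖F 0‖, fun z => ?_⟩
      rw [norm_div, div_mul_eq_mul_div]
      gcongr
      exact hC z)
    (fun z hz => h.im_eq_zero (fun h0 => hF0 (congrFun h0 0)) ((div_eq_zero_iff.mp hz).resolve_right
      hF0))
  refine ⟨hφ.isRealEntire_kernelTransform, (F 0).re, 0, 0, 0, w, fun z => F z / F 0, le_rfl, hw,
    fun z => ?_, fun z => ?_⟩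
  · have := hprod z
    rw [hderiv] at this
    simpa using this
  · rw [hF0']
    simp [mul_div_cancel₀ _ hF0]

/-- The Laguerre expressions are, up to positive constants, the cosine transforms of the associated
kernels; these determine positive definiteness. -/
theorem IsAdmissibleKernel.hasNonnegLaguerre_iff {φ : ℝ → ℝ} (hφ : IsAdmissibleKernel φ) :
    HasNonnegLaguerre (kernelTransform φ) ↔
      ∀ n, IsPositiveDefiniteKernel (associatedKernel φ n) := by
  constructor
  · intro h n
    set K := associatedKernel φ n with hK
    have hKi := hφ.integrable_associatedKernel n
    have hKc := hφ.continuous_associatedKernel n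
    -- the Fourier transform of `Kₙ` is `H`; the frequency `2πξ` corresponds to `x = πξ`
    set κ : ℝ := 2 * 2 ^ (2 * n) / (Nat.factorial (2 * n) : ℝ) with hκ
    have hκ0 : 0 < κ := by positivity
    set H : ℝ → ℝ := fun ξ => ∫ t : ℝ, K t * Real.cos (2 * (Real.pi * ξ) * t) with hH
    have hL : ∀ ξ : ℝ, laguerreExpression n (kernelTransform φ) (Real.pi * ξ : ℝ) = (κ * H ξ : ℝ) :=
      fun ξ => hφ.laguerreExpression_kernelTransform n (Real.pi * ξ)
    have hHnn : ∀ ξ, 0 ≤ H ξ := by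
      intro ξ
      have h1 := h.2 n (Real.pi * ξ)
      rw [hL] at h1
      exact nonneg_of_mul_nonneg_right (by exact_mod_cast h1) hκ0
    have hHi : Integrable H := by
      have h1 := ((hφ.integrable_laguerreExpression n).re).const_mul κ⁻¹
      refine h1.congr (Eventually.of_forall fun ξ => ?_)
      simp only
      rw [hL]
      simp [hκ0.ne']
    have hfour : FourierTransform.fourier (fun t => (K t : ℂ)) = fun ξ => (H ξ : ℂ) := by
      funext ξ
      rw [Real.fourier_real_eq_integral_exp_smul, hH]
      simp only
      rw [← integral_mul_exp_eq_integral_mul_cos hKi (associatedKernel_neg φ n),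
        ← integral_neg_eq_self]
      congr 1
      funext t
      rw [hK, associatedKernel_neg, smul_eq_mul, mul_comm]
      congr 2
      push_cast
      ring
    have hKcc : Continuous fun t => (K t : ℂ) := by fun_prop
    have hinv := hKcc.fourierInv_fourier_eq hKi.ofReal (by rw [hfour]; exact hHi.ofReal)
    refine isPositiveDefiniteKernel_of_eq_integral
      (H := fun ξ => (2 * Real.pi)⁻¹ * H ((2 * Real.pi)⁻¹ * ξ)) hKc
      ((hHi.comp_mul_left' (by positivity)).const_mul _)
      (fun ξ => mul_nonneg (by positivity) (hHnn _)) fun u => ?_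
    rw [← congrFun hinv u, hfour, Real.fourierInv_eq']
    have hcv := Measure.integral_comp_mul_left
      (fun ξ : ℝ => (H ξ : ℂ) * Complex.exp (Complex.I * (2 * Real.pi * u * ξ : ℝ)))
      (2 * Real.pi)⁻¹
    rw [inv_inv, abs_of_pos (by positivity)] at hcv
    have h3 : ∀ ξ : ℝ, (((2 * Real.pi)⁻¹ * H ((2 * Real.pi)⁻¹ * ξ) : ℝ) : ℂ) *
        Complex.exp (Complex.I * (u * ξ : ℝ)) = ((2 * Real.pi)⁻¹ : ℝ) *
        ((H ((2 * Real.pi)⁻¹ * ξ) : ℂ) * Complex.exp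
          (Complex.I * (2 * Real.pi * u * ((2 * Real.pi)⁻¹ * ξ) : ℝ))) := by
      intro ξ
      have : 2 * Real.pi * u * ((2 * Real.pi)⁻¹ * ξ) = u * ξ := by
        field_simp
      rw [this]
      push_cast
      ring
    simp only [h3]
    rw [integral_const_mul, hcv, Complex.real_smul, ← mul_assoc, ← Complex.ofReal_mul,
      inv_mul_cancel₀ (by positivity), Complex.ofReal_one, one_mul]
    congr 1
    funext ξ
    rw [smul_eq_mul, mul_comm, mul_comm Complex.I]
    congr 4
    simp
    ring
  · intro h
    refine ⟨hφ.differentiable_kernelTransform, fun n x => ?_⟩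
    rw [hφ.laguerreExpression_kernelTransform]
    have := (h n).integral_mul_cos_nonneg (hφ.integrable_associatedKernel n) (2 * x)
    exact_mod_cast mul_nonneg (by positivity) this

theorem theorem3p7 (φ : ℝ → ℝ) (hφ : IsAdmissibleKernel φ) (hlog : IsStrictlyLogConcave φ) :
    -- the integrals converge absolutely, and `F` is a real entire function
    (∀ z : ℂ, Integrable (fun t : ℝ => Complex.exp (Complex.I * (t : ℂ) * z) * (φ t : ℂ))) ∧
    IsRealEntire (kernelTransform φ) ∧
    (∀ (n : ℕ) (t : ℝ), Integrable (fun s : ℝ => φ (s + t) * φ (s - t) * s ^ (2 * n))) ∧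
    (∀ n : ℕ, Integrable (associatedKernel φ n)) ∧
    -- the formula for the generalized Laguerre expressions
    (∀ (n : ℕ) (x : ℝ),
      laguerreExpression n (kernelTransform φ) x =
        ((2 * 2 ^ (2 * n) / (Nat.factorial (2 * n) : ℝ) *
          ∫ t : ℝ, associatedKernel φ n t * Real.cos (2 * x * t) : ℝ) : ℂ)) ∧
    -- the characterization of membership in the Laguerre–Pólya class
    (IsLaguerrePolya (kernelTransform φ) ↔
      ∀ n : ℕ, IsPositiveDefiniteKernel (associatedKernel φ n)) :=
  ⟨hφ.integrable_exp_mul, hφ.isRealEntire_kernelTransform, hφ.integrable_associated_integrand,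
    hφ.integrable_associatedKernel, hφ.laguerreExpression_kernelTransform,
    fun h => hφ.hasNonnegLaguerre_iff.mp h.hasNonnegLaguerre,
    fun h => hφ.isLaguerrePolya_of_hasNonnegLaguerre (hφ.hasNonnegLaguerre_iff.mpr h)⟩
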